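/- Let $p:\tilde Y\to Y$ be a universal covering: $\tilde Y$ is simply connected and $p$ is the quotient map of a covering space action of a discrete group $\Gamma$ on $\tilde Y$ (an action by homeomorphisms such that every point has a neighbourhood $V$ with $gV\cap V=\emptyset$ for all $g\ne e$). Let $f:X\to Y$ be continuous, and let $\mathcal U=\{U_i\}_{i\in I}$ be a good cover of $X$, i.e. an open cover all of whose nonempty finite intersections are contractible. Let $N(\mathcal U)$ be its nerve (vertices: the $i$ with $U_i\neq\emptyset$), and choose a point $r(i)\in U_i$ for each vertex $i$. *Notation.* The edge groupoid $\mathcal E(K)$ of a simplicial complex $K$ has the vertices of $K$ as objects and, as morphisms, the classes of edge paths $v_0v_1\cdots v_m$ (successive vertices span a simplex) modulo the equivalence relation generated by replacing, inside a path, $uvw$ by $uw$ when $u,v,w$ span a simplex, and $vv$ by $v$; composition is concatenation. The edge group $E(K,u)$ is the group of morphisms from $u$ to $u$, and $\iota_u:E(K,u)\to\mathcal E(K)$ is the inclusion. An edge path $\eta=v_0\cdots v_m$ on $N(\mathcal U)$ carries a path $\gamma$ in $X$ if, after reparametrisation, $\gamma(k/m)\in U_{v_k}$ for $0\le k\le m$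 and $\gamma((k/m,(k+1)/m))\subset U_{v_k}\cup U_{v_{k+1}}$ for $0\le k<m$ (for $m=0$: $\gamma\subset U_{v_0}$). Let $\Pi$ denote the fundamental groupoid; products are in path order. For a pseudo-section $\lambda:Y\to\tilde Y$ (any map with $p\circ\lambda=\mathrm{id}$), the monodromy $\mu_\lambda:\Pi Y\to\Gamma$ sends the class of a path $\gamma$ from $y$ to $y'$ to the element $g$ such that the lift of $\gamma$ starting at $\lambda(y)$ ends at $g\cdot\lambda(y')$. Let $f^*p:\tilde X=X\times_Y\tilde Y\to X$ be the pullback of $p$, with $\Gamma$ acting on the second factor. An atlas of $f^*p$ is a family of $\Gamma$-equivariant homeomorphisms $\varphi_i:(f^*p)^{-1}(U_i)\to U_i\times\Gamma$ over $U_i$, where $h\cdot(x,g)=(x,hg)$; its transition homomorphism is the groupoid homomorphism $t:\mathcal E(N(\mathcal U))\to\Gamma$ with $\varphi_j\circ\varphi_i^{-1}(x,g)=(x,g\,t([ij]))$ for all $x\in U_i\cap U_j$ and $g\in\Gamma$. **Statement.** There is exactly one groupoid homomorphism $R:\mathcal E(N(\mathcal U))\to\Pi X$ with $R(i)=r(i)$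 that sends $[\eta]$ to $[\gamma]$ whenever the edge path $\eta$ from $i$ to $j$ carries the path $\gamma$ from $r(i)$ to $r(j)$. For every pseudo-section $\lambda$, $\mu_\lambda$ is a well-defined groupoid homomorphism, and every atlas of $f^*p$ has exactly one transition homomorphism. Moreover: 1. For every vertex $u$, $R$ restricts to an isomorphism $E(N(\mathcal U),u)\cong\pi_1(X,R(u))$, and for every pseudo-section $\lambda$ and every $y\in Y$, $\mu_\lambda$ restricts to an isomorphism $\pi_1(Y,y)\cong\Gamma$. 2. For every atlas of $f^*p$, with transition homomorphism $t$, and every vertex $u$, there is a pseudo-section $\lambda$ such that $$t\circ\iota_u=\mu_{\lambda}|_{\pi_1(Y,f(R(u)))}\circ\pi_1(f)\circ R|_{E(N(\mathcal U),u)};$$ and for an arbitrary pseudo-section $\lambda$ the two sides agree up to an inner automorphism of $\Gamma$. 3. For every pseudo-section $\lambda$ there is an atlas of $f^*p$ whose transition homomorphism $t$ satisfies the identity in 2 for all vertices $u$ simultaneously. -/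

import Mathlib

open CategoryTheory

/-! ### Groupoid homomorphisms to a group -/

/-- A groupoid homomorphism from `C` to a group `Γ` (a groupoid with one object), where
composition `a ⟶ b ⟶ c` in `C` is written in the order of `≫`: `t (α ≫ β) = t α * t β`. -/
@[ext]
structure GroupoidToGroup (C : Type*) [Groupoid C] (Γ : Type*) [Group Γ] where
  map : ∀ {a b : C}, (a ⟶ b) → Γ
  map_id : ∀ a : C, map (𝟙 a) = 1
  map_comp : ∀ {a b c : C} (α : a ⟶ b) (β : b ⟶ c), map (α ≫ β) = map α * map β

/-- The composite of the inclusion of the vertex group at `a` with a groupoid homomorphism to `Γ`.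
The vertex group `a ⟶ a` carries the product `α * β = α ≫ β`. -/
def GroupoidToGroup.onVertexGroup {C : Type*} [Groupoid C] {Γ : Type*} [Group Γ]
    (t : GroupoidToGroup C Γ) (a : C) : (a ⟶ a) →* Γ where
  toFun α := t.map α
  map_one' := t.map_id a
  map_mul' := t.map_comp

/-! ### Edge paths and the edge groupoid of a simplicial complex -/

namespace AbstractSimplicialComplex

variable {V : Type*}

/-- The vertices of `K`, as the vertices of the quiver whose arrows `v ⟶ w` are the pairs of
vertices spanning a simplex: there is exactly one arrow if `v = w` or `vw` is an edge, and none
otherwise. (Vertices span a simplex iff they lie in a common simplex.) -/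
def Vert (_K : AbstractSimplicialComplex V) : Type _ := V

instance (K : AbstractSimplicialComplex V) : Quiver K.Vert where
  Hom v w := PLift (∃ s ∈ K.faces, (v : V) ∈ s ∧ (w : V) ∈ s)

/-- Edge paths from `v` to `w`: finite sequences of vertices `v = v₀ v₁ ⋯ vₘ = w` in which
successive vertices span a simplex. -/
abbrev EdgePath (K : AbstractSimplicialComplex V) (v w : K.Vert) : Type _ := Quiver.Path v w

/-- Elementary contractions of edge paths (which may be applied anywhere inside a longer path):
`u v w` contracts to `u w` if `u, v, w` span a simplex, and `v v` contracts to `v`. -/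
inductive ElementaryContraction (K : AbstractSimplicialComplex V) : HomRel (Paths K.Vert)
  | triangle {u v w : K.Vert} (e₁ : u ⟶ v) (e₂ : v ⟶ w) (e₃ : u ⟶ w)
      (h : ∃ s ∈ K.faces, (u : V) ∈ s ∧ (v : V) ∈ s ∧ (w : V) ∈ s) :
      ElementaryContraction K ((Quiver.Path.nil.cons e₁).cons e₂ : Quiver.Path u w)
        (Quiver.Path.nil.cons e₃ : Quiver.Path u w)
  | stutter {v : K.Vert} (e : v ⟶ v) :
      ElementaryContraction K (Quiver.Path.nil.cons e : Quiver.Path v v)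
        (Quiver.Path.nil : Quiver.Path v v)

/-- The edge groupoid of `K`: objects are the vertices, morphisms are the classes of edge paths
modulo the equivalence relation generated by elementary contractions inside a path, and
composition is concatenation. -/
def EdgeGroupoid (K : AbstractSimplicialComplex V) : Type _ :=
  CategoryTheory.Quotient (ElementaryContraction K)

namespace EdgeGroupoid

variable {K : AbstractSimplicialComplex V}

instance : Category (EdgeGroupoid K) :=
  inferInstanceAs (Category (CategoryTheory.Quotient (ElementaryContraction K)))

/-- A vertex as an object of the edge groupoid. -/
def vertex (v : K.Vert) : EdgeGroupoid K := ⟨v⟩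

/-- The edge homotopy class of an edge path. -/
def cls {v w : K.Vert} (η : K.EdgePath v w) :
    (vertex v : EdgeGroupoid K) ⟶ vertex w :=
  (CategoryTheory.Quotient.functor (ElementaryContraction K)).map η

theorem cls_nil (v : K.Vert) :
    cls (Quiver.Path.nil : K.EdgePath v v) = 𝟙 (vertex v : EdgeGroupoid K) :=
  (CategoryTheory.Quotient.functor (ElementaryContraction K)).map_id v

theorem cls_comp {v w z : K.Vert} (η : K.EdgePath v w) (θ : K.EdgePath w z) :
    cls (η.comp θ) = cls η ≫ cls θ :=
  (CategoryTheory.Quotient.functor (ElementaryContraction K)).map_comp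
    (X := (v : Paths K.Vert)) η θ

theorem isIso_edge {v w : K.Vert} (e : v ⟶ w) :
    IsIso (cls (Quiver.Path.nil.cons e : K.EdgePath v w)) := by
  have key : ∀ {a b : K.Vert} (e : a ⟶ b) (e' : b ⟶ a),
      cls (Quiver.Path.nil.cons e : K.EdgePath a b) ≫ cls (Quiver.Path.nil.cons e') = 𝟙 _ := by
    intro a b e e'
    obtain ⟨s, hs, ha, hb⟩ := e.down
    rw [← cls_comp, ← cls_nil]
    exact (CategoryTheory.Quotient.sound _ (ElementaryContraction.triangle e e'
        ⟨⟨s, hs, ha, ha⟩⟩ ⟨s, hs, ha, hb, ha⟩)).trans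
      (CategoryTheory.Quotient.sound _ (ElementaryContraction.stutter _))
  obtain ⟨s, hs, hv, hw⟩ := e.down
  exact ⟨cls (Quiver.Path.nil.cons ⟨⟨s, hs, hw, hv⟩⟩), key _ _, key _ _⟩

theorem isIso_cls {v w : K.Vert} (η : K.EdgePath v w) : IsIso (cls η) := by
  induction η with
  | nil => rw [cls_nil]; infer_instance
  | cons η e ih =>
    have := isIso_edge e
    have h : cls (η.cons e) = cls η ≫ cls (Quiver.Path.nil.cons e) :=
      cls_comp η (Quiver.Path.nil.cons e)
    rw [h]
    infer_instance

noncomputable instance : Groupoid (EdgeGroupoid K) :=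
  Groupoid.ofIsIso fun {a b} f => by
    obtain ⟨η, rfl⟩ := (CategoryTheory.Quotient.functor
      (ElementaryContraction K)).map_surjective (X := a.as) (Y := b.as) f
    exact isIso_cls η

end EdgeGroupoid

end AbstractSimplicialComplex

open AbstractSimplicialComplex

/-! ### Good covers and their nerves -/

/-- An open cover all of whose nonempty finite intersections are contractible. -/
structure IsGoodCover {X ι : Type*} [TopologicalSpace X] (U : ι → Set X) : Prop where
  isOpen : ∀ i, IsOpen (U i)
  covers : ⋃ i, U i = Set.univ
  contractible : ∀ J : Finset ι, J.Nonempty → (⋂ i ∈ J, U i).Nonempty →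
    ContractibleSpace (⋂ i ∈ J, U i : Set X)

/-- The nerve of a family of sets. Its vertices are the indices of the nonempty members. -/
def nerveOf {X ι : Type*} (U : ι → Set X) :
    AbstractSimplicialComplex {i : ι // (U i).Nonempty} where
  faces := {J | J.Nonempty ∧ (⋂ i ∈ J, U i.1).Nonempty}
  isRelLowerSet_faces := fun _ hJ =>
    ⟨hJ.1, fun _ hsub hne => ⟨hne, hJ.2.mono (Set.biInter_subset_biInter_left hsub)⟩⟩
  singleton_mem := fun i => ⟨Finset.singleton_nonempty i, by simpa using i.2⟩

/-- The member of the cover that belongs to a vertex of the nerve. -/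
def coverSet {X ι : Type*} (U : ι → Set X) (i : (nerveOf U).Vert) : Set X :=
  U (Subtype.val (p := fun i : ι => (U i).Nonempty) i)

/-! ### Realisation of edge paths -/

/-- The edge path `η = v₀ ⋯ vₘ` on the nerve carries `γ`: up to a (weakly monotone)
reparametrisation sending `k / m` to `τ k`, the point `γ (k / m)` lies in `U_{vₖ}` and
`γ (k / m, (k + 1) / m)` lies in `U_{vₖ} ∪ U_{vₖ₊₁}`. A constant edge path `v₀` carries the paths
inside `U_{v₀}`. -/
def Carries {X ι : Type*} [TopologicalSpace X] (U : ι → Set X) {i j : (nerveOf U).Vert}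
    (η : (nerveOf U).EdgePath i j) {x y : X} (γ : Path x y) : Prop :=
  (η.length = 0 ∧ ∀ s, γ s ∈ coverSet U i) ∨
  ∃ τ : ℕ → unitInterval, Monotone τ ∧ τ 0 = 0 ∧ τ η.length = 1 ∧
    (∀ (k : ℕ) (hk : k < η.vertices.length), γ (τ k) ∈ coverSet U η.vertices[k]) ∧
    ∀ (k : ℕ) (hk : k + 1 < η.vertices.length), ∀ s ∈ Set.Ioo (τ k) (τ (k + 1)),
      γ s ∈ coverSet U η.vertices[k] ∪ coverSet U η.vertices[k + 1]

/-- `R` is the realisation homomorphism from the edge groupoid of the nerve to the fundamental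
groupoid determined by the choice of points `r i ∈ U_i`: it sends the vertex `i` to `r i`, and the
class of an edge path `η` to the class of any path (between the right points) carried by `η`. -/
def IsRealisation {X ι : Type*} [TopologicalSpace X] (U : ι → Set X)
    (r : (nerveOf U).Vert → X) (R : EdgeGroupoid (nerveOf U) ⥤ FundamentalGroupoid X) : Prop :=
  (∀ i, R.obj (EdgeGroupoid.vertex i) = ⟨r i⟩) ∧
  ∀ (i j : (nerveOf U).Vert) (η : (nerveOf U).EdgePath i j)
    (γ : Path (R.obj (EdgeGroupoid.vertex i)).as (R.obj (EdgeGroupoid.vertex j)).as),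
    Carries U η γ → R.map (EdgeGroupoid.cls η) = Path.Homotopic.Quotient.mk γ

/-! ### Monodromy -/

/-- `μ` is the monodromy homomorphism of `p` with respect to the pseudo-section `lam`: each path
`γ` from `y` to `y'` has a lift from `lam y` to `μ [γ] • lam y'`. -/
def IsMonodromy {E Y Γ : Type*} [TopologicalSpace E] [TopologicalSpace Y] [Group Γ]
    [MulAction Γ E] (p : E → Y) (lam : Y → E)
    (μ : GroupoidToGroup (FundamentalGroupoid Y) Γ) : Prop :=
  ∀ (y y' : FundamentalGroupoid Y) (γ : Path y.as y'.as),
    ∃ δ : Path (lam y.as) (μ.map (show y ⟶ y' from Path.Homotopic.Quotient.mk γ) • lam y'.as),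
      ∀ s, p (δ s) = γ s

/-! ### Induced coverings -/

section InducedCovering

variable {X Y E Γ : Type*} [TopologicalSpace X] [TopologicalSpace Y] [TopologicalSpace E]
  [Group Γ] [MulAction Γ E]

/-- The total space `{(x, e) | f x = p e}` of the pullback of `p` along `f`. -/
def InducedCovering (f : C(X, Y)) {p : E → Y} (_hp : IsQuotientCoveringMap p Γ) : Type _ :=
  Function.Pullback f p

namespace InducedCovering

variable {f : C(X, Y)} {p : E → Y} {hp : IsQuotientCoveringMap p Γ}

instance : TopologicalSpace (InducedCovering f hp) :=
  inferInstanceAs (TopologicalSpace (Function.Pullback f p))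

/-- `Γ` acts on the pullback through the second factor. -/
instance : MulAction Γ (InducedCovering f hp) where
  smul g z := ⟨(z.1.1, g • z.1.2), z.2.trans (hp.map_smul g).symm⟩
  one_smul z := Subtype.ext (Prod.ext rfl (one_smul Γ z.1.2))
  mul_smul g h z := Subtype.ext (Prod.ext rfl (mul_smul g h z.1.2))

variable (f hp) in
/-- The covering map of the pullback, `(x, e) ↦ x`. -/
def proj (z : InducedCovering f hp) : X := z.1.1

end InducedCovering

end InducedCovering

/-! ### Atlases and transition homomorphisms -/

/-- A chart of `q : E → X` over `S`: a `Γ`-equivariant homeomorphism from `q⁻¹(S)` to `S × Γ`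
over `S`, where `Γ` acts on `S × Γ` by `h • (x, g) = (x, h * g)`. -/
structure GammaChart (Γ : Type*) [Group Γ] [TopologicalSpace Γ] {E X : Type*} [TopologicalSpace E]
    [TopologicalSpace X] [MulAction Γ E] (q : E → X) (S : Set X) where
  toHomeomorph : (q ⁻¹' S : Set E) ≃ₜ S × Γ
  fst_apply : ∀ z, ((toHomeomorph z).1 : X) = q z
  equivariant : ∀ (g : Γ) (z : E) (hz : q z ∈ S) (hgz : q (g • z) ∈ S),
    (toHomeomorph ⟨g • z, hgz⟩).2 = g * (toHomeomorph ⟨z, hz⟩).2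

/-- An atlas of `q` for the cover `U`: a chart over each (nonempty) member. -/
abbrev GammaAtlas (Γ : Type*) [Group Γ] [TopologicalSpace Γ] {E X ι : Type*} [TopologicalSpace E]
    [TopologicalSpace X] [MulAction Γ E] (q : E → X) (U : ι → Set X) : Type _ :=
  ∀ i : (nerveOf U).Vert, GammaChart Γ q (coverSet U i)

/-- `t` is the transition homomorphism of the atlas: for each pair `i, j` with `U_i ∩ U_j`
nonempty, the transition map `φ_j ∘ φ_i⁻¹` on `(U_i ∩ U_j) × Γ` is `(x, g) ↦ (x, g * t [ij])`. -/
def IsTransition {Γ : Type*} [Group Γ] [TopologicalSpace Γ] {E X ι : Type*} [TopologicalSpace E]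
    [TopologicalSpace X] [MulAction Γ E] {q : E → X} {U : ι → Set X} (φ : GammaAtlas Γ q U)
    (t : GroupoidToGroup (EdgeGroupoid (nerveOf U)) Γ) : Prop :=
  ∀ (i j : (nerveOf U).Vert) (e : i ⟶ j) (x : X) (hi : x ∈ coverSet U i) (hj : x ∈ coverSet U j)
    (g : Γ) (hq : q ((φ i).toHomeomorph.symm (⟨x, hi⟩, g)) ∈ coverSet U j),
    (φ j).toHomeomorph ⟨(φ i).toHomeomorph.symm (⟨x, hi⟩, g), hq⟩ =
      (⟨x, hj⟩, g * t.map (EdgeGroupoid.cls (Quiver.Path.nil.cons e)))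

/-! ### The square -/

/-- The square with sides `π₁(f)`, the realisation `R`, the monodromy `μ` and the restriction of
`t` to the edge group at `i` commutes: `t ∘ ι = μ ∘ π₁(f) ∘ R` as group homomorphisms from the
edge group at `i` to `Γ`. -/
def SquareCommutes {X Y Γ V : Type*} [TopologicalSpace X] [TopologicalSpace Y] [Group Γ]
    {K : AbstractSimplicialComplex V} (f : C(X, Y)) (R : EdgeGroupoid K ⥤ FundamentalGroupoid X)
    (μ : GroupoidToGroup (FundamentalGroupoid Y) Γ) (t : GroupoidToGroup (EdgeGroupoid K) Γ)
    (i : K.Vert) : Prop :=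
  t.onVertexGroup (EdgeGroupoid.vertex i) =
    (μ.onVertexGroup ((FundamentalGroupoid.map f).obj (R.obj (EdgeGroupoid.vertex i)))).comp
      (((FundamentalGroupoid.map f).mapVertexGroup (R.obj (EdgeGroupoid.vertex i))).comp
        (R.mapVertexGroup (EdgeGroupoid.vertex i)))

/-! Inside a member of a good cover two points are joined by exactly one homotopy class of paths
(`seg`), and two members containing both points give the same class because their intersection is
path connected (`seg_eq_seg`). So crossing from `U_i` to `U_j` defines a class that does not depend
on the crossing point, and crossing at a common point of three members gives the triangle relation.
This defines `R`. Subdividing a path shows that every carried path has the prescribed class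
(`mk_subpath_eq`) and that `R` is onto vertex groups (`exists_factorization`).

For injectivity, a homomorphism `t` from the edge groupoid to a discrete group `G` glues the
products `U_i × G` to a covering of `X` whose monodromy along `R α` is right multiplication by `t α`
(`flatCoord_monodromy_realise`). Hence `R α = 1` forces `t α = 1`. Taking for `t` a retraction onto
the vertex group, which is injective there, gives `α = 1`.

A pseudo-section `lam` of `p` induces the pseudo-section `x ↦ (x, lam (f x))` of the pullback. Let
`a i` be its coordinate at `r i` in the chart `φ i`. Chart coordinates are constant along paths in
the total space lying over one member, so `t = (a i)⁻¹ * μ (f (R _)) * a j` on morphisms from `i` to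
`j` (`transition_eq`). On a vertex group this is a conjugation, and the square commutes when `a i =
1`. That is arranged at one vertex by adjusting `lam`, and at all vertices at once by choosing the
charts (`exists_chart`). -/

/-! ### Interval induction -/

/-- Compactness gives a finite monotone subdivision each of whose steps lies in one of the sets `N`;
transitivity chains the steps together. -/
theorem unitInterval.rel_of_locally {Q : unitInterval → unitInterval → Prop}
    (trans : ∀ a b c, Q a b → Q b c → Q a c)
    (loc : ∀ s, ∃ N : Set unitInterval, IsOpen N ∧ s ∈ N ∧
      ∀ a b, a ≤ b → Set.Icc a b ⊆ N → Q a b) : Q 0 1 := by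
  choose N hN hmem hQ using loc
  obtain ⟨t, t0, tmono, ⟨n, hn⟩, ht⟩ := exists_monotone_Icc_subset_open_cover_unitInterval hN
    (fun s _ => Set.mem_iUnion.2 ⟨s, hmem s⟩)
  have step : ∀ m, Q (t m) (t (m + 1)) := fun m => by
    obtain ⟨s, hs⟩ := ht m
    exact hQ s _ _ (tmono m.le_succ) hs
  -- The chain starts with the first step, because `Q` is not assumed reflexive.
  have key : ∀ m, Q 0 (t (m + 1)) := by
    intro m
    induction m with
    | zero => simpa [t0] using step 0
    | succ m ih => exact trans _ _ _ ih (step _)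
  simpa [hn (n + 1) n.le_succ] using key n

/-! ### Classes of paths inside a member of a good cover -/

section Nerve

variable {X ι : Type*} {U : ι → Set X}

theorem mem_faces_of_forall_mem {s : Finset {i : ι // (U i).Nonempty}} (hs : s.Nonempty) {x : X}
    (hx : ∀ i ∈ s, x ∈ U i.1) : s ∈ (nerveOf U).faces :=
  ⟨hs, x, Set.mem_iInter₂.2 hx⟩

theorem exists_face₃ {i j k : (nerveOf U).Vert} {x : X} (hi : x ∈ coverSet U i)
    (hj : x ∈ coverSet U j) (hk : x ∈ coverSet U k) :
    ∃ s ∈ (nerveOf U).faces, (i : {i : ι // (U i).Nonempty}) ∈ s ∧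
      (j : {i : ι // (U i).Nonempty}) ∈ s ∧ (k : {i : ι // (U i).Nonempty}) ∈ s := by
  classical
  have key : ∀ i j k : {i : ι // (U i).Nonempty}, x ∈ U i.1 → x ∈ U j.1 → x ∈ U k.1 →
      ∃ s ∈ (nerveOf U).faces, i ∈ s ∧ j ∈ s ∧ k ∈ s := by
    intro i j k hi hj hk
    refine ⟨{i, j, k}, mem_faces_of_forall_mem (Finset.insert_nonempty _ _) (x := x) ?_,
      by simp, by simp, by simp⟩
    intro l hl
    simp only [Finset.mem_insert, Finset.mem_singleton] at hl
    rcases hl with rfl | rfl | rfl <;> assumption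
  exact key i j k hi hj hk

theorem exists_face₂ {i j : (nerveOf U).Vert} {x : X} (hi : x ∈ coverSet U i)
    (hj : x ∈ coverSet U j) :
    ∃ s ∈ (nerveOf U).faces, (i : {i : ι // (U i).Nonempty}) ∈ s ∧
      (j : {i : ι // (U i).Nonempty}) ∈ s :=
  let ⟨s, hs, hi, _, hj⟩ := exists_face₃ hi hi hj
  ⟨s, hs, hi, hj⟩

/-- The edge of the nerve between two members that share a point. -/
def nerveEdge {i j : (nerveOf U).Vert} {x : X} (hi : x ∈ coverSet U i) (hj : x ∈ coverSet U j) :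
    i ⟶ j :=
  ⟨exists_face₂ hi hj⟩

theorem exists_mem_of_edge {i j : (nerveOf U).Vert} (e : i ⟶ j) :
    ∃ x, x ∈ coverSet U i ∧ x ∈ coverSet U j := by
  obtain ⟨s, ⟨-, x, hx⟩, hi, hj⟩ := e.down
  exact ⟨x, Set.mem_iInter₂.1 hx _ hi, Set.mem_iInter₂.1 hx _ hj⟩

instance (i j : (nerveOf U).Vert) : Subsingleton (i ⟶ j) :=
  ⟨fun ⟨_⟩ ⟨_⟩ => rfl⟩

end Nerve

namespace IsGoodCover

variable {X ι : Type*} [TopologicalSpace X] {U : ι → Set X} (hU : IsGoodCover U)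

include hU

theorem isOpen_coverSet (i : (nerveOf U).Vert) : IsOpen (coverSet U i) := hU.isOpen _

theorem exists_mem_coverSet (x : X) : ∃ i : (nerveOf U).Vert, x ∈ coverSet U i := by
  obtain ⟨i, hi⟩ := Set.mem_iUnion.1 (hU.covers.symm ▸ Set.mem_univ x : x ∈ ⋃ i, U i)
  exact ⟨(⟨i, x, hi⟩ : {i : ι // (U i).Nonempty}), hi⟩

theorem contractibleSpace_coverSet (i : (nerveOf U).Vert) : ContractibleSpace (coverSet U i) := by
  let i' : {i : ι // (U i).Nonempty} := i
  have h : (⋂ k ∈ ({i'.1} : Finset ι), U k) = coverSet U i := by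
    simp only [Finset.mem_singleton, Set.iInter_iInter_eq_left]; rfl
  have := hU.contractible {i'.1} (Finset.singleton_nonempty _) (h ▸ i'.2)
  rwa [h] at this

theorem isPathConnected_inter {i j : (nerveOf U).Vert} {x : X} (hi : x ∈ coverSet U i)
    (hj : x ∈ coverSet U j) : IsPathConnected (coverSet U i ∩ coverSet U j) := by
  classical
  let i' : {i : ι // (U i).Nonempty} := i
  let j' : {i : ι // (U i).Nonempty} := j
  have h : (⋂ k ∈ ({i'.1, j'.1} : Finset ι), U k) = coverSet U i ∩ coverSet U j := by
    simp only [Finset.mem_insert, Finset.mem_singleton, Set.iInter_iInter_eq_or_left,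
      Set.iInter_iInter_eq_left]; rfl
  have := hU.contractible {i'.1, j'.1} (Finset.insert_nonempty _ _) (h ▸ ⟨x, hi, hj⟩)
  rw [h] at this
  exact isPathConnected_iff_pathConnectedSpace.2 inferInstance

/-- A contractible set is simply connected, and a homotopy inside it maps forward along the
inclusion. -/
theorem mk_eq_mk_of_mem (i : (nerveOf U).Vert) {x y : X} (γ γ' : Path x y)
    (h : ∀ s, γ s ∈ coverSet U i) (h' : ∀ s, γ' s ∈ coverSet U i) :
    Path.Homotopic.Quotient.mk γ = Path.Homotopic.Quotient.mk γ' := by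
  have := hU.contractibleSpace_coverSet i
  have hx : x ∈ coverSet U i := by simpa using h 0
  have hy : y ∈ coverSet U i := by simpa using h 1
  let δ : Path (⟨x, hx⟩ : coverSet U i) ⟨y, hy⟩ :=
    { toFun := fun s => ⟨γ s, h s⟩, source' := by simp, target' := by simp }
  let δ' : Path (⟨x, hx⟩ : coverSet U i) ⟨y, hy⟩ :=
    { toFun := fun s => ⟨γ' s, h' s⟩, source' := by simp, target' := by simp }
  exact Path.Homotopic.Quotient.eq.2
    ((SimplyConnectedSpace.paths_homotopic δ δ').map ⟨Subtype.val, continuous_subtype_val⟩)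

theorem exists_path (i : (nerveOf U).Vert) {x y : X} (hx : x ∈ coverSet U i)
    (hy : y ∈ coverSet U i) : ∃ γ : Path x y, ∀ s, γ s ∈ coverSet U i := by
  have := hU.contractibleSpace_coverSet i
  have h := (isPathConnected_iff_pathConnectedSpace.2 inferInstance :
    IsPathConnected (coverSet U i)).joinedIn x hx y hy
  exact ⟨h.somePath, h.somePath_mem⟩

/-- The class of the paths inside a member of a good cover between two of its points. -/
noncomputable def seg (i : (nerveOf U).Vert) {x y : X} (hx : x ∈ coverSet U i)
    (hy : y ∈ coverSet U i) : (⟨x⟩ : FundamentalGroupoid X) ⟶ ⟨y⟩ :=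
  Path.Homotopic.Quotient.mk (hU.exists_path i hx hy).choose

theorem seg_eq (i : (nerveOf U).Vert) {x y : X} (hx : x ∈ coverSet U i) (hy : y ∈ coverSet U i)
    (γ : Path x y) (h : ∀ s, γ s ∈ coverSet U i) :
    hU.seg i hx hy = Path.Homotopic.Quotient.mk γ :=
  hU.mk_eq_mk_of_mem i _ _ (hU.exists_path i hx hy).choose_spec h

theorem seg_self (i : (nerveOf U).Vert) {x : X} (hx hx' : x ∈ coverSet U i) :
    hU.seg i hx hx' = 𝟙 _ :=
  hU.seg_eq i hx hx (Path.refl x) fun _ => hx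

theorem seg_comp (i : (nerveOf U).Vert) {x y z : X} (hx : x ∈ coverSet U i)
    (hy : y ∈ coverSet U i) (hz : z ∈ coverSet U i) :
    hU.seg i hx hy ≫ hU.seg i hy hz = hU.seg i hx hz := by
  obtain ⟨γ, hγ⟩ := hU.exists_path i hx hy
  obtain ⟨γ', hγ'⟩ := hU.exists_path i hy hz
  rw [hU.seg_eq i hx hy γ hγ, hU.seg_eq i hy hz γ' hγ', hU.seg_eq i hx hz (γ.trans γ')]
  · rfl
  · intro s
    have : γ.trans γ' s ∈ Set.range (γ.trans γ') := ⟨s, rfl⟩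
    rw [Path.trans_range] at this
    rcases this with ⟨t, ht⟩ | ⟨t, ht⟩
    · exact ht ▸ hγ t
    · exact ht ▸ hγ' t

theorem seg_comp_assoc (i : (nerveOf U).Vert) {x y z : X} (hx : x ∈ coverSet U i)
    (hy : y ∈ coverSet U i) (hz : z ∈ coverSet U i) {a : FundamentalGroupoid X} (f : ⟨z⟩ ⟶ a) :
    hU.seg i hx hy ≫ hU.seg i hy hz ≫ f = hU.seg i hx hz ≫ f := by
  rw [← Category.assoc, seg_comp]

/-- A path in the intersection represents both sides; this is where path connectedness of pairwise
intersections enters. -/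
theorem seg_eq_seg {i j : (nerveOf U).Vert} {x y : X} (hx : x ∈ coverSet U i)
    (hy : y ∈ coverSet U i) (hx' : x ∈ coverSet U j) (hy' : y ∈ coverSet U j) :
    hU.seg i hx hy = hU.seg j hx' hy' := by
  have h := (hU.isPathConnected_inter hx hx').joinedIn x ⟨hx, hx'⟩ y ⟨hy, hy'⟩
  rw [hU.seg_eq i hx hy h.somePath fun s => (h.somePath_mem s).1,
    hU.seg_eq j hx' hy' h.somePath fun s => (h.somePath_mem s).2]

variable {r : (nerveOf U).Vert → X} (hr : ∀ i, r i ∈ coverSet U i)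

/-- The class of the paths carried by an edge of the nerve. -/
noncomputable def edgeClass {i j : (nerveOf U).Vert} (e : i ⟶ j) :
    (⟨r i⟩ : FundamentalGroupoid X) ⟶ ⟨r j⟩ :=
  hU.seg i (hr i) (exists_mem_of_edge e).choose_spec.1 ≫
    hU.seg j (exists_mem_of_edge e).choose_spec.2 (hr j)

/-- Two crossing points are joined by a segment of `U i` that is also a segment of `U j`, so the
crossing point can be moved freely. -/
theorem edgeClass_eq {i j : (nerveOf U).Vert} (e : i ⟶ j) {x : X} (hi : x ∈ coverSet U i)
    (hj : x ∈ coverSet U j) : hU.edgeClass hr e = hU.seg i (hr i) hi ≫ hU.seg j hj (hr j) := by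
  obtain ⟨hi', hj'⟩ := (exists_mem_of_edge e).choose_spec
  rw [edgeClass, ← hU.seg_comp i (hr i) hi hi', hU.seg_eq_seg hi hi' hj hj', Category.assoc,
    hU.seg_comp]

theorem edgeClass_self {i : (nerveOf U).Vert} (e : i ⟶ i) : hU.edgeClass hr e = 𝟙 _ := by
  rw [hU.edgeClass_eq hr e (hr i) (hr i), seg_self, Category.comp_id]

/-- When all crossings take place at the common point `x`, the two segments inside `U j` cancel. Of
the triple intersection only nonemptiness is used. -/
theorem edgeClass_comp {i j k : (nerveOf U).Vert} (e₁ : i ⟶ j) (e₂ : j ⟶ k) (e₃ : i ⟶ k)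
    {x : X} (hi : x ∈ coverSet U i) (hj : x ∈ coverSet U j) (hk : x ∈ coverSet U k) :
    hU.edgeClass hr e₁ ≫ hU.edgeClass hr e₂ = hU.edgeClass hr e₃ := by
  rw [hU.edgeClass_eq hr e₁ hi hj, hU.edgeClass_eq hr e₂ hj hk, hU.edgeClass_eq hr e₃ hi hk,
    Category.assoc, seg_comp_assoc, seg_self, Category.id_comp]

/-- A path in the union of some members of a good cover is a product of edge classes, up to paths
inside the first and the last member. -/
theorem exists_factorization (A : Set (nerveOf U).Vert)
    (M : ∀ k l : (nerveOf U).Vert, Set ((⟨r k⟩ : FundamentalGroupoid X) ⟶ ⟨r l⟩))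
    (hedge : ∀ k ∈ A, ∀ l ∈ A, ∀ e : k ⟶ l, hU.edgeClass hr e ∈ M k l)
    (hcomp : ∀ k ∈ A, ∀ l ∈ A, ∀ m ∈ A, ∀ α ∈ M k l, ∀ β ∈ M l m, α ≫ β ∈ M k m)
    {x y : X} (γ : Path x y) (hγ : ∀ s, ∃ k ∈ A, γ s ∈ coverSet U k)
    {k l : (nerveOf U).Vert} (hk : k ∈ A) (hl : l ∈ A) (hx : x ∈ coverSet U k)
    (hy : y ∈ coverSet U l) :
    ∃ α ∈ M k l, (Path.Homotopic.Quotient.mk γ : (⟨x⟩ : FundamentalGroupoid X) ⟶ ⟨y⟩) =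
      hU.seg k hx (hr k) ≫ α ≫ hU.seg l (hr l) hy := by
  -- Quantifying over all members containing the endpoints leaves transitivity free to pick any
  -- member at the middle point.
  let Q : unitInterval → unitInterval → Prop := fun a b => ∀ k ∈ A, ∀ l ∈ A,
    ∀ (ha : γ a ∈ coverSet U k) (hb : γ b ∈ coverSet U l), ∃ α ∈ M k l,
      (Path.Homotopic.Quotient.mk (γ.subpath a b) : (⟨γ a⟩ : FundamentalGroupoid X) ⟶ ⟨γ b⟩) =
        hU.seg k ha (hr k) ≫ α ≫ hU.seg l (hr l) hb
  have key : Q 0 1 := by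
    refine unitInterval.rel_of_locally ?_ ?_
    · intro a b c hab hbc k hk m hm ha hc
      obtain ⟨l, hl, hb⟩ := hγ b
      obtain ⟨α, hα, hα'⟩ := hab k hk l hl ha hb
      obtain ⟨β, hβ, hβ'⟩ := hbc l hl m hm hb hc
      refine ⟨α ≫ β, hcomp k hk l hl m hm α hα β hβ, ?_⟩
      have h : FundamentalGroupoid.fromPath (Path.Homotopic.Quotient.mk (γ.subpath a c)) =
          FundamentalGroupoid.fromPath (Path.Homotopic.Quotient.mk (γ.subpath a b)) ≫
          FundamentalGroupoid.fromPath (Path.Homotopic.Quotient.mk (γ.subpath b c)) :=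
        (Path.Homotopic.Quotient.eq.2 ⟨Path.Homotopy.subpathTransSubpath γ a b c⟩).symm
      refine h.trans ((congrArg₂ (· ≫ ·) hα' hβ').trans ?_)
      simp only [Category.assoc]
      rw [hU.seg_comp_assoc, hU.seg_self, Category.id_comp]
    · intro s
      obtain ⟨m, hm, hs⟩ := hγ s
      refine ⟨γ ⁻¹' coverSet U m, (hU.isOpen_coverSet m).preimage γ.continuous, hs, ?_⟩
      intro a b hab hN k hk l hl ha hb
      have ha' : γ a ∈ coverSet U m := hN (Set.left_mem_Icc.2 hab)
      have hb' : γ b ∈ coverSet U m := hN (Set.right_mem_Icc.2 hab)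
      -- The subpath lies in `U m`, so detour from `k` to `m` at its start and from `m` to `l` at
      -- its end.
      refine ⟨hU.edgeClass hr (nerveEdge ha ha') ≫ hU.edgeClass hr (nerveEdge hb' hb),
        hcomp k hk m hm l hl _ (hedge k hk m hm _) _ (hedge m hm l hl _), ?_⟩
      rw [hU.edgeClass_eq hr _ ha ha', hU.edgeClass_eq hr _ hb' hb]
      simp only [Category.assoc]
      rw [hU.seg_comp_assoc, hU.seg_comp_assoc, hU.seg_self, hU.seg_comp, hU.seg_self,
        Category.id_comp, Category.comp_id]
      symm
      refine hU.seg_eq m ha' hb' _ fun t => ?_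
      have : γ.subpath a b t ∈ Set.range (γ.subpath a b) := ⟨t, rfl⟩
      rw [Path.range_subpath_of_le _ _ _ hab] at this
      obtain ⟨u, hu, hut⟩ := this
      exact hut ▸ hN hu
  have h0 : γ 0 = x := γ.source
  have h1 : γ 1 = y := γ.target
  obtain ⟨α, hα, h⟩ := key k hk l hl (by rwa [h0]) (by rwa [h1])
  refine ⟨α, hα, ?_⟩
  rw [Path.subpath_zero_one] at h
  -- The endpoints `γ 0` and `γ 1` equal `x` and `y` only propositionally; with variable endpoints
  -- the equalities can be eliminated.
  have aux : ∀ {x' y' : X} (h0 : x' = x) (h1 : y' = y) (hx' : x' ∈ coverSet U k)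
      (hy' : y' ∈ coverSet U l),
      (Path.Homotopic.Quotient.mk (γ.cast h0 h1) : (⟨x'⟩ : FundamentalGroupoid X) ⟶ ⟨y'⟩) =
        hU.seg k hx' (hr k) ≫ α ≫ hU.seg l (hr l) hy' →
      (Path.Homotopic.Quotient.mk γ : (⟨x⟩ : FundamentalGroupoid X) ⟶ ⟨y⟩) =
        hU.seg k hx (hr k) ≫ α ≫ hU.seg l (hr l) hy := by
    rintro _ _ rfl rfl _ _
    exact id
  exact aux _ _ _ _ h

/-- The homotopy class of a path in the union of two members that meet. -/
theorem mk_eq_of_mem_union {i j : (nerveOf U).Vert} (e : i ⟶ j) {x y : X} (γ : Path x y)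
    (hγ : ∀ s, γ s ∈ coverSet U i ∪ coverSet U j) (hx : x ∈ coverSet U i)
    (hy : y ∈ coverSet U j) :
    (Path.Homotopic.Quotient.mk γ : (⟨x⟩ : FundamentalGroupoid X) ⟶ ⟨y⟩) =
      hU.seg i hx (hr i) ≫ hU.edgeClass hr e ≫ hU.seg j (hr j) hy := by
  obtain ⟨z, hzi, hzj⟩ := exists_mem_of_edge e
  have hz : ∀ k ∈ ({i, j} : Set (nerveOf U).Vert), z ∈ coverSet U k := by
    rintro k (rfl | rfl)
    exacts [hzi, hzj]
  -- Edge classes within `{i, j}` are closed under composition, since `z` lies in both members. The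
  -- whole factor is therefore a single edge class.
  obtain ⟨α, ⟨e', rfl⟩, h⟩ := hU.exists_factorization hr ({i, j} : Set (nerveOf U).Vert)
    (fun k l => {α | ∃ e : k ⟶ l, hU.edgeClass hr e = α})
    (fun k _ l _ e => ⟨e, rfl⟩)
    (by
      rintro k hk l hl m hm _ ⟨e₁, rfl⟩ _ ⟨e₂, rfl⟩
      exact ⟨nerveEdge (hz k hk) (hz m hm),
        (hU.edgeClass_comp hr e₁ e₂ _ (hz k hk) (hz l hl) (hz m hm)).symm⟩)
    γ (fun s => (hγ s).elim (fun h => ⟨i, by simp, h⟩) (fun h => ⟨j, by simp, h⟩))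
    (k := i) (l := j) (by simp) (by simp) hx hy
  rw [h, Subsingleton.elim e' e]

end IsGoodCover

/-! ### Functors and homomorphisms on the edge groupoid -/

/-- The composite of a functor with a groupoid homomorphism to `Γ`, conjugated by a family of
elements of `Γ`. -/
def GroupoidToGroup.compConj {C D Γ : Type*} [Groupoid C] [Groupoid D] [Group Γ]
    (μ : GroupoidToGroup D Γ) (F : C ⥤ D) (a : C → Γ) : GroupoidToGroup C Γ where
  map {x y} α := (a x)⁻¹ * μ.map (F.map α) * a y
  map_id x := by simp [μ.map_id]
  map_comp α β := by simp [μ.map_comp, mul_assoc]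

/-- A homomorphism from a groupoid to the vertex group at `u` that conjugates each automorphism of
`u` by a fixed element. -/
theorem CategoryTheory.Groupoid.exists_retraction {C : Type*} [Groupoid C] (u : C) :
    ∃ t : GroupoidToGroup C (u ⟶ u), ∃ θ : u ⟶ u, ∀ α : u ⟶ u, t.map α = θ * α * θ⁻¹ := by
  classical
  have h : ∀ a : C, ∃ θ : Nonempty (u ⟶ a) → (u ⟶ a), True :=
    fun a => ⟨fun h => h.some, trivial⟩
  choose θ _ using h
  refine ⟨
    -- On the component of `u`, chosen morphisms from `u` close `α` up to a loop; on other
    -- components the value is `1`.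
    { map := fun {a b} α => if h : Nonempty (u ⟶ a) then
        θ a h ≫ α ≫ Groupoid.inv (θ b ⟨h.some ≫ α⟩) else 𝟙 u
      map_id := fun a => by
        split_ifs with h
        · simp
        · rfl
      map_comp := fun {a b c} α β => by
        by_cases h : Nonempty (u ⟶ a)
        · have h' : Nonempty (u ⟶ b) := ⟨h.some ≫ α⟩
          rw [dif_pos h, dif_pos h, dif_pos h']
          simp [Groupoid.vertexGroup_mul]
        · have h' : ¬ Nonempty (u ⟶ b) := fun ⟨γ⟩ => h ⟨γ ≫ Groupoid.inv α⟩
          rw [dif_neg h, dif_neg h, dif_neg h']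
          exact (mul_one (1 : u ⟶ u)).symm }, θ u ⟨𝟙 u⟩, fun α => ?_⟩
  change dite _ _ _ = _
  rw [dif_pos ⟨𝟙 u⟩, mul_assoc]
  rfl

namespace AbstractSimplicialComplex.EdgeGroupoid

variable {V : Type*} {K : AbstractSimplicialComplex V}

/-- The class of an edge. -/
abbrev edge {v w : K.Vert} (e : v ⟶ w) : (vertex v : EdgeGroupoid K) ⟶ vertex w :=
  cls (Quiver.Path.nil.cons e : K.EdgePath v w)

theorem cls_cons {u v w : K.Vert} (η : K.EdgePath u v) (e : v ⟶ w) :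
    cls (η.cons e) = cls η ≫ edge e :=
  cls_comp η (Quiver.Path.nil.cons e)

theorem edge_comp {u v w : K.Vert} (e₁ : u ⟶ v) (e₂ : v ⟶ w) (e₃ : u ⟶ w)
    (h : ∃ s ∈ K.faces, (u : V) ∈ s ∧ (v : V) ∈ s ∧ (w : V) ∈ s) :
    edge e₁ ≫ edge e₂ = edge e₃ :=
  (cls_cons _ _).symm.trans
    (CategoryTheory.Quotient.sound _ (ElementaryContraction.triangle e₁ e₂ e₃ h))

theorem edge_self {v : K.Vert} (e : v ⟶ v) : edge e = 𝟙 (vertex v : EdgeGroupoid K) :=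
  CategoryTheory.Quotient.sound _ (ElementaryContraction.stutter e)

theorem exists_cls {v w : K.Vert} (α : (vertex v : EdgeGroupoid K) ⟶ vertex w) :
    ∃ η : K.EdgePath v w, cls η = α :=
  (CategoryTheory.Quotient.functor (ElementaryContraction K)).map_surjective
    (X := show Paths K.Vert from v) (Y := show Paths K.Vert from w) α

/-- The functor on the edge groupoid with given values on edges. -/
def lift {D : Type*} [Category D] (o : K.Vert → D) (w : ∀ {i j : K.Vert}, (i ⟶ j) → (o i ⟶ o j))
    (hself : ∀ {i : K.Vert} (e : i ⟶ i), w e = 𝟙 (o i))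
    (hcomp : ∀ {i j k : K.Vert} (e₁ : i ⟶ j) (e₂ : j ⟶ k) (e₃ : i ⟶ k),
      (∃ s ∈ K.faces, (i : V) ∈ s ∧ (j : V) ∈ s ∧ (k : V) ∈ s) → w e₁ ≫ w e₂ = w e₃) :
    EdgeGroupoid K ⥤ D :=
  CategoryTheory.Quotient.lift (ElementaryContraction K)
    (Paths.lift { obj := o, map := fun e => w e } : Paths K.Vert ⥤ D) (by
      intro x y f₁ f₂ h
      cases h with
      | triangle e₁ e₂ e₃ h =>
        change (𝟙 _ ≫ w e₁) ≫ w e₂ = 𝟙 _ ≫ w e₃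
        rw [Category.id_comp, Category.id_comp]
        exact hcomp e₁ e₂ e₃ h
      | stutter e =>
        change 𝟙 _ ≫ w e = 𝟙 _
        exact (Category.id_comp _).trans (hself e))

theorem lift_edge {D : Type*} [Category D] (o : K.Vert → D)
    (w : ∀ {i j : K.Vert}, (i ⟶ j) → (o i ⟶ o j))
    (hself : ∀ {i : K.Vert} (e : i ⟶ i), w e = 𝟙 (o i))
    (hcomp : ∀ {i j k : K.Vert} (e₁ : i ⟶ j) (e₂ : j ⟶ k) (e₃ : i ⟶ k),
      (∃ s ∈ K.faces, (i : V) ∈ s ∧ (j : V) ∈ s ∧ (k : V) ∈ s) → w e₁ ≫ w e₂ = w e₃)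
    {i j : K.Vert} (e : i ⟶ j) : (lift o w hself hcomp).map (edge e) = w e :=
  Category.id_comp _

theorem exists_groupoidToGroup {Γ : Type*} [Group Γ] (w : ∀ {i j : K.Vert}, (i ⟶ j) → Γ)
    (hself : ∀ {i : K.Vert} (e : i ⟶ i), w e = 1)
    (hcomp : ∀ {i j k : K.Vert} (e₁ : i ⟶ j) (e₂ : j ⟶ k) (e₃ : i ⟶ k),
      (∃ s ∈ K.faces, (i : V) ∈ s ∧ (j : V) ∈ s ∧ (k : V) ∈ s) → w e₁ * w e₂ = w e₃) :
    ∃ t : GroupoidToGroup (EdgeGroupoid K) Γ, ∀ {i j : K.Vert} (e : i ⟶ j),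
      t.map (edge e) = w e := by
  -- Composition in `SingleObj` reverses the product, and `Γᵐᵒᵖ` restores path order.
  let F : EdgeGroupoid K ⥤ SingleObj Γᵐᵒᵖ := lift (fun _ => SingleObj.star _)
    (fun e => MulOpposite.op (w e)) (fun e => by rw [hself]; rfl)
    (fun e₁ e₂ e₃ h => by rw [← hcomp e₁ e₂ e₃ h]; rfl)
  have hF : ∀ {i j : K.Vert} (e : i ⟶ j), F.map (edge e) = MulOpposite.op (w e) :=
    fun e => lift_edge _ _ _ _ e
  refine ⟨
    { map := fun α => MulOpposite.unop (F.map α : Γᵐᵒᵖ)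
      map_id := fun a => by rw [F.map_id]; rfl
      map_comp := fun α β => by rw [F.map_comp]; rfl }, fun e => ?_⟩
  change MulOpposite.unop (F.map (edge e) : Γᵐᵒᵖ) = w e
  rw [hF]
  rfl

theorem groupoidToGroup_ext {Γ : Type*} [Group Γ] {t t' : GroupoidToGroup (EdgeGroupoid K) Γ}
    (h : ∀ {i j : K.Vert} (e : i ⟶ j), t.map (edge e) = t'.map (edge e)) : t = t' := by
  have key : ∀ {i j : K.Vert} (η : K.EdgePath i j), t.map (cls η) = t'.map (cls η) := by
    intro i j η
    induction η with
    | nil => rw [cls_nil, t.map_id, t'.map_id]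
    | cons η e ih => rw [cls_cons, t.map_comp, t'.map_comp, ih, h]
  ext a b α
  obtain ⟨η, rfl⟩ := exists_cls (v := a.as) (w := b.as) α
  exact key η

end AbstractSimplicialComplex.EdgeGroupoid

/-! ### The realisation homomorphism -/

namespace IsGoodCover

open EdgeGroupoid

variable {X ι : Type*} [TopologicalSpace X] {U : ι → Set X} (hU : IsGoodCover U)
  {r : (nerveOf U).Vert → X} (hr : ∀ i, r i ∈ coverSet U i)

/-- The realisation homomorphism of a good cover with chosen points. -/
noncomputable def realisation : EdgeGroupoid (nerveOf U) ⥤ FundamentalGroupoid X :=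
  lift (fun i => ⟨r i⟩) (fun e => hU.edgeClass hr e) (fun e => hU.edgeClass_self hr e) (by
    rintro i j k e₁ e₂ e₃ ⟨s, ⟨-, x, hx⟩, hi, hj, hk⟩
    exact hU.edgeClass_comp hr e₁ e₂ e₃ (Set.mem_iInter₂.1 hx _ hi) (Set.mem_iInter₂.1 hx _ hj)
      (Set.mem_iInter₂.1 hx _ hk))

/-- The value of the realisation homomorphism on a morphism between vertices. -/
noncomputable def realise {i j : (nerveOf U).Vert}
    (α : (vertex i : EdgeGroupoid (nerveOf U)) ⟶ vertex j) :
    (⟨r i⟩ : FundamentalGroupoid X) ⟶ ⟨r j⟩ :=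
  (hU.realisation hr).map α

theorem realise_id (i : (nerveOf U).Vert) : hU.realise hr (𝟙 (vertex i)) = 𝟙 _ :=
  (hU.realisation hr).map_id _

theorem realise_comp {i j k : (nerveOf U).Vert}
    (α : (vertex i : EdgeGroupoid (nerveOf U)) ⟶ vertex j) (β : vertex j ⟶ vertex k) :
    hU.realise hr (α ≫ β) = hU.realise hr α ≫ hU.realise hr β :=
  (hU.realisation hr).map_comp _ _

theorem realise_edge {i j : (nerveOf U).Vert} (e : i ⟶ j) :
    hU.realise hr (edge e) = hU.edgeClass hr e :=
  Category.id_comp _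

/-- Induction on the edge path: each new edge adds a piece of `γ` in a union of two members, whose
class is given by `mk_eq_of_mem_union`. The segments to the base points cancel at the junction. -/
theorem mk_subpath_eq {x y : X} (γ : Path x y) {τ : ℕ → unitInterval} (hτ : Monotone τ)
    {i j : (nerveOf U).Vert} (η : (nerveOf U).EdgePath i j)
    (hv : ∀ (k : ℕ) (hk : k < η.vertices.length), γ (τ k) ∈ coverSet U η.vertices[k])
    (he : ∀ (k : ℕ) (hk : k + 1 < η.vertices.length), ∀ s ∈ Set.Ioo (τ k) (τ (k + 1)),
      γ s ∈ coverSet U η.vertices[k] ∪ coverSet U η.vertices[k + 1])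
    (hi : γ (τ 0) ∈ coverSet U i) (hj : γ (τ η.length) ∈ coverSet U j) :
    FundamentalGroupoid.fromPath (Path.Homotopic.Quotient.mk (γ.subpath (τ 0) (τ η.length))) =
      hU.seg i hi (hr i) ≫ hU.realise hr (cls η) ≫ hU.seg j (hr j) hj := by
  induction η with
  | nil =>
    have hi' : γ (τ 0) ∈ coverSet U i := hj
    change _ = hU.seg i hi (hr i) ≫ hU.realise hr (𝟙 _) ≫ hU.seg i (hr i) hi'
    rw [realise_id, Category.id_comp, hU.seg_comp, hU.seg_self]
    exact congrArg Path.Homotopic.Quotient.mk (Path.subpath_self γ (τ 0))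
  | @cons j k η e ih =>
    change γ (τ (η.length + 1)) ∈ coverSet U k at hj
    have hlen := η.vertices_length
    have hlast : η.vertices[η.length]'(by omega) = j := by
      have := η.vertices_getLast
      rw [List.getLast_eq_getElem] at this
      simpa [hlen] using this
    have hj' : γ (τ η.length) ∈ coverSet U j := by
      have := hv η.length (by simp)
      simp only [Quiver.Path.vertices_cons, List.concat_eq_append] at this
      rwa [List.getElem_append_left (by omega), hlast] at this
    have ih' := ih (fun l hl => by
        have := hv l (by simp; omega)
        simp only [Quiver.Path.vertices_cons, List.concat_eq_append] at this
        rwa [List.getElem_append_left hl] at this)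
      (fun l hl s hs => by
        have := he l (by simp; omega) s hs
        simp only [Quiver.Path.vertices_cons, List.concat_eq_append] at this
        rwa [List.getElem_append_left hl, List.getElem_append_left (by omega)] at this) hj'
    have hstep : FundamentalGroupoid.fromPath (Path.Homotopic.Quotient.mk
        (γ.subpath (τ η.length) (τ (η.length + 1)))) =
        hU.seg j hj' (hr j) ≫ hU.edgeClass hr e ≫ hU.seg k (hr k) hj := by
      refine hU.mk_eq_of_mem_union hr e _ (fun s => ?_) hj' hj
      have hs : γ.subpath (τ η.length) (τ (η.length + 1)) s ∈
        Set.range (γ.subpath (τ η.length) (τ (η.length + 1))) := ⟨s, rfl⟩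
      rw [Path.range_subpath_of_le _ _ _ (hτ (Nat.le_succ _))] at hs
      obtain ⟨u, ⟨hu₁, hu₂⟩, hus⟩ := hs
      rw [← hus]
      -- The union condition covers only the open interval; the endpoints are handled by the vertex
      -- conditions.
      rcases hu₁.eq_or_lt with rfl | hu₁
      · exact Or.inl hj'
      · rcases hu₂.eq_or_lt with rfl | hu₂
        · exact Or.inr hj
        · have := he η.length (by simp) u ⟨hu₁, hu₂⟩
          simp only [Quiver.Path.vertices_cons, List.concat_eq_append] at this
          rw [List.getElem_append_left (by omega), hlast,
            List.getElem_append_right (by omega)] at this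
          simpa [hlen] using this
    have hsplit : FundamentalGroupoid.fromPath (Path.Homotopic.Quotient.mk
        (γ.subpath (τ 0) (τ (η.length + 1)))) =
        FundamentalGroupoid.fromPath (Path.Homotopic.Quotient.mk
          (γ.subpath (τ 0) (τ η.length))) ≫ FundamentalGroupoid.fromPath
          (Path.Homotopic.Quotient.mk (γ.subpath (τ η.length) (τ (η.length + 1)))) :=
      (Path.Homotopic.Quotient.eq.2 ⟨Path.Homotopy.subpathTransSubpath γ _ _ _⟩).symm
    refine hsplit.trans ((congrArg₂ (· ≫ ·) ih' hstep).trans ?_)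
    rw [cls_cons, realise_comp, realise_edge]
    simp only [Category.assoc]
    rw [hU.seg_comp_assoc, hU.seg_self, Category.id_comp]
    rfl

theorem isRealisation_realisation : IsRealisation U r (hU.realisation hr) := by
  refine ⟨fun _ => rfl, fun i j η γ hγ => ?_⟩
  rcases hγ with ⟨hlen, hγ⟩ | ⟨τ, hτ, h0, h1, hv, he⟩
  · cases η with
    | nil =>
      exact (hU.realise_id hr i).trans
        ((hU.seg_self i (hr i) (hr i)).symm.trans (hU.seg_eq i _ _ γ hγ))
    | cons η e => simp at hlen
  · change Path (r i) (r j) at γ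
    change hU.realise hr (cls η) = _
    have hs : γ 0 = r i := γ.source
    have ht : γ 1 = r j := γ.target
    have hi : γ (τ 0) ∈ coverSet U i := by rw [h0, hs]; exact hr i
    have hj : γ (τ η.length) ∈ coverSet U j := by rw [h1, ht]; exact hr j
    have key := hU.mk_subpath_eq hr γ hτ η hv he hi hj
    -- The type of the subpath depends on `τ 0` and `τ η.length`, so these become variables before
    -- substitution.
    generalize τ 0 = a at h0 hi key
    generalize τ η.length = b at h1 hj key
    subst h0 h1
    rw [Path.subpath_zero_one] at key
    have aux : ∀ {x y : X} (hx : x = r i) (hy : y = r j) (hx' : x ∈ coverSet U i)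
        (hy' : y ∈ coverSet U j),
        FundamentalGroupoid.fromPath (Path.Homotopic.Quotient.mk (γ.cast hx hy)) =
          hU.seg i hx' (hr i) ≫ hU.realise hr (cls η) ≫ hU.seg j (hr j) hy' →
        hU.realise hr (cls η) = Path.Homotopic.Quotient.mk γ := by
      rintro _ _ rfl rfl hx' hy' h
      rw [hU.seg_self, hU.seg_self, Category.id_comp, Category.comp_id] at h
      exact h.symm
    exact aux hs ht hi hj key

theorem carries_edge {i j : (nerveOf U).Vert} (e : i ⟶ j) {x y z : X} (γ : Path x y)
    (γ' : Path y z) (h : ∀ s, γ s ∈ coverSet U i) (h' : ∀ s, γ' s ∈ coverSet U j) :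
    Carries U (Quiver.Path.nil.cons e) (γ.trans γ') := by
  -- Only `τ 0 = 0` and `τ 1 = 1` matter for a single edge; the value `1` thereafter keeps `τ`
  -- monotone.
  refine Or.inr ⟨fun k => if k = 0 then 0 else 1, ?_, rfl, rfl, ?_, ?_⟩
  · intro a b hab
    dsimp only
    split_ifs with h₁ h₂
    · exact le_rfl
    · exact zero_le_one
    · omega
    · exact le_rfl
  · intro k hk
    have hk : k < 2 := hk
    interval_cases k
    · have := h 0
      simp only [if_true, Path.source] at this ⊢
      exact this
    · have := h' 1
      simp only [Path.target, one_ne_zero, if_false] at this ⊢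
      exact this
  · intro k hk s _
    have hk : k + 1 < 2 := hk
    obtain rfl : k = 0 := by omega
    have : γ.trans γ' s ∈ Set.range (γ.trans γ') := ⟨s, rfl⟩
    rw [Path.trans_range] at this
    rcases this with ⟨t, ht⟩ | ⟨t, ht⟩
    · exact Or.inl (ht ▸ h t)
    · exact Or.inr (ht ▸ h' t)

/-- Every edge carries a path crossing at a common point, so the condition fixes `R` on edges, and
these generate the groupoid. -/
theorem eq_realisation {R : EdgeGroupoid (nerveOf U) ⥤ FundamentalGroupoid X}
    (hR : IsRealisation U r R) : R = hU.realisation hr := by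
  obtain rfl : r = fun i => (R.obj (vertex i)).as :=
    funext fun i => (congrArg FundamentalGroupoid.as (hR.1 i)).symm
  have hedge : ∀ {i j : (nerveOf U).Vert} (e : i ⟶ j), R.map (edge e) = hU.edgeClass hr e := by
    intro i j e
    obtain ⟨x, hi, hj⟩ := exists_mem_of_edge e
    obtain ⟨γ, hγ⟩ := hU.exists_path i (hr i) hi
    obtain ⟨γ', hγ'⟩ := hU.exists_path j hj (hr j)
    rw [hU.edgeClass_eq hr e hi hj, hU.seg_eq i _ _ γ hγ, hU.seg_eq j _ _ γ' hγ']
    exact hR.2 i j _ (γ.trans γ') (carries_edge e γ γ' hγ hγ')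
  have key : ∀ {i j : (nerveOf U).Vert} (η : (nerveOf U).EdgePath i j),
      R.map (cls η) = hU.realise hr (cls η) := by
    intro i j η
    induction η with
    | nil => exact (R.map_id _).trans (hU.realise_id hr _).symm
    | cons η e ih =>
      rw [cls_cons, realise_comp, realise_edge]
      exact (R.map_comp _ _).trans (congrArg₂ (· ≫ ·) ih (hedge e))
  refine Functor.hext (fun _ => rfl) fun a b α => heq_of_eq ?_
  obtain ⟨η, rfl⟩ := exists_cls (v := a.as) (w := b.as) α
  exact key η

theorem realisation_surjective (i : (nerveOf U).Vert) :
    Function.Surjective ((hU.realisation hr).mapVertexGroup (vertex i)) := by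
  intro β
  change Path.Homotopic.Quotient (r i) (r i) at β
  obtain ⟨γ, rfl⟩ := Path.Homotopic.Quotient.mk_surjective β
  -- Here the multiplicative family is the image of `R`, and all members of the cover are allowed.
  obtain ⟨_, ⟨α, rfl⟩, h⟩ := hU.exists_factorization hr Set.univ
    (fun k l => {β | ∃ α : (vertex k : EdgeGroupoid (nerveOf U)) ⟶ vertex l,
      hU.realise hr α = β})
    (fun k _ l _ e => ⟨edge e, hU.realise_edge hr e⟩)
    (by
      rintro k - l - m - _ ⟨α, rfl⟩ _ ⟨β, rfl⟩
      exact ⟨α ≫ β, hU.realise_comp hr α β⟩)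
    γ (fun s => (hU.exists_mem_coverSet (γ s)).imp fun _ h => ⟨trivial, h⟩)
    (Set.mem_univ i) (Set.mem_univ i) (hr i) (hr i)
  refine ⟨α, ?_⟩
  rw [hU.seg_self, Category.id_comp, Category.comp_id] at h
  exact h.symm

end IsGoodCover

/-! ### The flat bundle of a homomorphism on the edge groupoid of the nerve -/

namespace IsGoodCover

open EdgeGroupoid

variable {X ι : Type*} [TopologicalSpace X] {U : ι → Set X} (hU : IsGoodCover U)

open Classical in
/-- The bundle with fibre `G` whose transition functions are the right multiplications by the values
of `t` on edges. -/
noncomputable def flatBundle {G : Type*} [Group G] [TopologicalSpace G] [DiscreteTopology G]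
    (t : GroupoidToGroup (EdgeGroupoid (nerveOf U)) G) : FiberBundleCore (nerveOf U).Vert X G where
  baseSet := coverSet U
  isOpen_baseSet := hU.isOpen_coverSet
  indexAt x := (hU.exists_mem_coverSet x).choose
  mem_baseSet_at x := (hU.exists_mem_coverSet x).choose_spec
  coordChange i j x g := if h : x ∈ coverSet U i ∧ x ∈ coverSet U j then
    g * t.map (edge (nerveEdge h.1 h.2)) else g
  coordChange_self i x hx g := by rw [dif_pos ⟨hx, hx⟩, edge_self, t.map_id, mul_one]
  continuousOn_coordChange i j := by
    -- Without an edge the intersection is empty. With one, the change of coordinates is the same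
    -- right multiplication at every point of the intersection.
    by_cases hne : Nonempty (i ⟶ j)
    · obtain ⟨e⟩ := hne
      have hc : Continuous fun p : X × G => p.2 * t.map (edge e) :=
        (continuous_of_discreteTopology (f := fun g : G => g * t.map (edge e))).comp continuous_snd
      refine hc.continuousOn.congr fun p hp => ?_
      dsimp only
      rw [dif_pos (And.intro hp.1.1 hp.1.2), Subsingleton.elim (nerveEdge _ _) e]
    · rintro p hp
      exact (hne ⟨nerveEdge hp.1.1 hp.1.2⟩).elim
  coordChange_comp i j k x hx g := by
    obtain ⟨⟨hi, hj⟩, hk⟩ := hx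
    rw [dif_pos ⟨hj, hk⟩, dif_pos ⟨hi, hj⟩, dif_pos ⟨hi, hk⟩, mul_assoc, ← t.map_comp,
      edge_comp _ _ _ (exists_face₃ hi hj hk)]

section FlatBundle

variable {G : Type*} [Group G] [TopologicalSpace G] [DiscreteTopology G]
  (t : GroupoidToGroup (EdgeGroupoid (nerveOf U)) G)

theorem isCoveringMap_flatBundle : IsCoveringMap (hU.flatBundle t).proj :=
  FiberBundle.isCoveringMap (F := G) (E := (hU.flatBundle t).Fiber)

/-- The fibre coordinate in the chart over a member of the cover. -/
noncomputable def flatCoord (i : (nerveOf U).Vert) (z : (hU.flatBundle t).TotalSpace) : G :=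
  ((hU.flatBundle t).localTriv i z).2

/-- A continuous map from the interval to a discrete space is constant. -/
theorem flatCoord_eq_of_path (i : (nerveOf U).Vert) {z z' : (hU.flatBundle t).TotalSpace}
    (δ : Path z z') (h : ∀ s, (δ s).1 ∈ coverSet U i) :
    hU.flatCoord t i z' = hU.flatCoord t i z := by
  have hc : Continuous fun s => hU.flatCoord t i (δ s) :=
    continuous_snd.comp ((((hU.flatBundle t).localTriv i).continuousOn_toFun).comp_continuous
      δ.continuous h)
  have := PreconnectedSpace.constant inferInstance hc (x := 1) (y := 0)
  simpa using this

theorem flatCoord_change {i j : (nerveOf U).Vert} (e : i ⟶ j)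
    (z : (hU.flatBundle t).TotalSpace) (hi : z.1 ∈ coverSet U i) (hj : z.1 ∈ coverSet U j) :
    hU.flatCoord t j z = hU.flatCoord t i z * t.map (edge e) := by
  have h := (hU.flatBundle t).coordChange_comp ((hU.flatBundle t).indexAt z.1) i j z.1
    ⟨⟨(hU.flatBundle t).mem_baseSet_at z.1, hi⟩, hj⟩ z.2
  refine h.symm.trans ?_
  refine (dif_pos ⟨hi, hj⟩).trans ?_
  rw [Subsingleton.elim (nerveEdge _ _) e]
  rfl

theorem flatCoord_monodromy_seg (i : (nerveOf U).Vert) {x y : X} (hx : x ∈ coverSet U i)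
    (hy : y ∈ coverSet U i) (z : (hU.flatBundle t).proj ⁻¹' {x}) :
    hU.flatCoord t i ((hU.isCoveringMap_flatBundle t).monodromy (hU.seg i hx hy) z).1 =
      hU.flatCoord t i z.1 := by
  obtain ⟨γ, hγ⟩ := hU.exists_path i hx hy
  rw [hU.seg_eq i hx hy γ hγ]
  have h0 : γ 0 = (hU.flatBundle t).proj z.1 := γ.source.trans z.2.symm
  refine hU.flatCoord_eq_of_path t i
    (⟨(hU.isCoveringMap_flatBundle t).liftPath γ z.1 h0,
      (hU.isCoveringMap_flatBundle t).liftPath_zero _ _ h0, rfl⟩ : Path _ _) fun s => ?_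
  have := congrFun ((hU.isCoveringMap_flatBundle t).liftPath_lifts γ z.1 h0) s
  exact Set.mem_of_eq_of_mem this (hγ s)

variable {r : (nerveOf U).Vert → X} (hr : ∀ i, r i ∈ coverSet U i)

theorem flatCoord_monodromy_edgeClass {i j : (nerveOf U).Vert} (e : i ⟶ j)
    (z : (hU.flatBundle t).proj ⁻¹' {r i}) :
    hU.flatCoord t j ((hU.isCoveringMap_flatBundle t).monodromy (hU.edgeClass hr e) z).1 =
      hU.flatCoord t i z.1 * t.map (edge e) := by
  obtain ⟨x, hi, hj⟩ := exists_mem_of_edge e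
  have h : hU.edgeClass hr e =
      Path.Homotopic.Quotient.trans (hU.seg i (hr i) hi) (hU.seg j hj (hr j)) :=
    hU.edgeClass_eq hr e hi hj
  rw [h, IsCoveringMap.monodromy_trans_apply, flatCoord_monodromy_seg,
    hU.flatCoord_change t e, flatCoord_monodromy_seg]
  · have := ((hU.isCoveringMap_flatBundle t).monodromy (hU.seg i (hr i) hi) z).2
    exact Set.mem_of_eq_of_mem this hi
  · have := ((hU.isCoveringMap_flatBundle t).monodromy (hU.seg i (hr i) hi) z).2
    exact Set.mem_of_eq_of_mem this hj

/-- This recovers `t α` from `R α` alone, which is what makes the flat bundle detect the kernel of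
`R`. -/
theorem flatCoord_monodromy_realise {i j : (nerveOf U).Vert}
    (α : (vertex i : EdgeGroupoid (nerveOf U)) ⟶ vertex j)
    (z : (hU.flatBundle t).proj ⁻¹' {r i}) :
    hU.flatCoord t j ((hU.isCoveringMap_flatBundle t).monodromy (hU.realise hr α) z).1 =
      hU.flatCoord t i z.1 * t.map α := by
  obtain ⟨η, rfl⟩ := exists_cls α
  induction η with
  | nil =>
    rw [cls_nil, realise_id, t.map_id, mul_one]
    exact congrArg (fun f : _ → _ => hU.flatCoord t i (f z).1)
      (hU.isCoveringMap_flatBundle t).monodromy_refl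
  | cons η e ih =>
    have h : hU.realise hr (cls (η.cons e)) =
        Path.Homotopic.Quotient.trans (hU.realise hr (cls η)) (hU.edgeClass hr e) := by
      rw [cls_cons, realise_comp, realise_edge]
      rfl
    rw [h, IsCoveringMap.monodromy_trans_apply, flatCoord_monodromy_edgeClass, ih, cls_cons,
      t.map_comp, mul_assoc]

end FlatBundle

variable {r : (nerveOf U).Vert → X} (hr : ∀ i, r i ∈ coverSet U i)

theorem realisation_injective (i : (nerveOf U).Vert) :
    Function.Injective ((hU.realisation hr).mapVertexGroup (vertex i)) := by
  rw [injective_iff_map_eq_one]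
  intro α hα
  obtain ⟨t, θ, ht⟩ := Groupoid.exists_retraction (vertex i : EdgeGroupoid (nerveOf U))
  let : TopologicalSpace ((vertex i : EdgeGroupoid (nerveOf U)) ⟶ vertex i) := ⊥
  have : DiscreteTopology ((vertex i : EdgeGroupoid (nerveOf U)) ⟶ vertex i) := ⟨rfl⟩
  let z : (hU.flatBundle t).proj ⁻¹' {r i} := ⟨⟨r i, (1 : vertex i ⟶ vertex i)⟩, rfl⟩
  have h := hU.flatCoord_monodromy_realise t hr α z
  have hα' : hU.realise hr α = Path.Homotopic.Quotient.refl (r i) := hα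
  rw [hα', IsCoveringMap.monodromy_refl, id, left_eq_mul, ht] at h
  exact conj_eq_one_iff.1 h

end IsGoodCover

/-! ### Monodromy of a quotient covering map -/

namespace IsQuotientCoveringMap

variable {E Y Γ : Type*} [TopologicalSpace E] [TopologicalSpace Y] [Group Γ] [MulAction Γ E]
  {p : E → Y} (hp : IsQuotientCoveringMap p Γ) {lam : Y → E} (hlam : ∀ y, p (lam y) = y)

include hp

theorem smul_left_injective {g h : Γ} {e : E} (H : g • e = h • e) : g = h :=
  hp.isCancelSMul.right_cancel _ _ _ H

include hlam

/-- Unique path lifting turns the existence of a lift with given ends into an equation for the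
endpoint of the canonical lift. -/
theorem isMonodromy_iff {μ : GroupoidToGroup (FundamentalGroupoid Y) Γ} :
    IsMonodromy p lam μ ↔ ∀ (y y' : FundamentalGroupoid Y) (α : y ⟶ y'),
      μ.map α • lam y'.as =
        (hp.isCoveringMap.monodromy (x := y.as) (y := y'.as) α ⟨lam y.as, hlam _⟩).1 := by
  constructor
  · intro h y y' α
    obtain ⟨γ, rfl⟩ := Path.Homotopic.Quotient.mk_surjective (x₀ := y.as) (x₁ := y'.as) α
    obtain ⟨δ, hδ⟩ := h y y' γ
    have h0 : γ 0 = p (lam y.as) := γ.source.trans (hlam _).symm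
    have := (hp.isCoveringMap.eq_liftPath_iff' h0 (Γ := δ.toContinuousMap)).2
      ⟨funext hδ, δ.source⟩
    exact δ.target.symm.trans (congrArg (fun g : C(unitInterval, E) => g 1) this)
  · intro h y y' γ
    have h0 : γ 0 = p (lam y.as) := γ.source.trans (hlam _).symm
    exact ⟨⟨hp.isCoveringMap.liftPath γ (lam y.as) h0, hp.isCoveringMap.liftPath_zero _ _ h0,
      (h y y' (Path.Homotopic.Quotient.mk γ)).symm⟩,
      congrFun (hp.isCoveringMap.liftPath_lifts γ (lam y.as) h0)⟩

theorem existsUnique_isMonodromy :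
    ∃! μ : GroupoidToGroup (FundamentalGroupoid Y) Γ, IsMonodromy p lam μ := by
  have hex : ∀ {y y' : FundamentalGroupoid Y} (α : y ⟶ y'), ∃ g : Γ, g • lam y'.as =
      (hp.isCoveringMap.monodromy (x := y.as) (y := y'.as) α ⟨lam y.as, hlam _⟩).1 := by
    intro y y' α
    refine hp.apply_eq_iff_mem_orbit.1 (Eq.trans ?_ (hlam y'.as).symm)
    exact (hp.isCoveringMap.monodromy (x := y.as) (y := y'.as) α ⟨lam y.as, hlam _⟩).2
  choose m hm using @hex
  -- Lifting commutes with the action of `Γ`; this is what makes `m` multiplicative in path order.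
  have hsmul : ∀ {y y' : FundamentalGroupoid Y} (α : y ⟶ y') (g : Γ) (e : p ⁻¹' {y.as}),
      e.1 = g • lam y.as →
      (hp.isCoveringMap.monodromy (x := y.as) (y := y'.as) α e).1 = g • m α • lam y'.as := by
    intro y y' α g e he
    have := hp.monodromy_toPermFiber (γ := (α : Path.Homotopic.Quotient y.as y'.as)) (g := g)
      (e := ⟨lam y.as, hlam _⟩)
    obtain rfl : e = hp.toPermFiber y.as g ⟨lam y.as, hlam _⟩ := Subtype.ext he
    rw [hm]
    exact congrArg Subtype.val this
  refine ⟨⟨m, fun y => ?_, fun {a b c} α β => ?_⟩, (hp.isMonodromy_iff hlam).2 fun y y' α => hm α,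
    fun μ hμ => ?_⟩
  · refine hp.smul_left_injective (e := lam y.as) ?_
    rw [hm, one_smul]
    exact congrArg Subtype.val
      (congrFun hp.isCoveringMap.monodromy_refl (⟨lam y.as, hlam _⟩ : p ⁻¹' {y.as}))
  · refine hp.smul_left_injective (e := lam c.as) ?_
    rw [hm, mul_smul, ← hsmul β (m α) _ (hm α).symm]
    exact congrArg Subtype.val (hp.isCoveringMap.monodromy_trans_apply _ _ _)
  · ext a b α
    refine hp.smul_left_injective (e := lam b.as) ?_
    rw [(hp.isMonodromy_iff hlam).1 hμ]
    exact (hm α).symm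

/-- Up to passing to the opposite group, `μ` is the standard comparison of the fundamental group
with the deck group, bijective because `E` is simply connected. -/
theorem bijective_onVertexGroup [SimplyConnectedSpace E]
    {μ : GroupoidToGroup (FundamentalGroupoid Y) Γ} (hμ : IsMonodromy p lam μ)
    (y : FundamentalGroupoid Y) : Function.Bijective (μ.onVertexGroup y) := by
  let e : p ⁻¹' {y.as} := ⟨lam y.as, hlam _⟩
  have h : ∀ α : y ⟶ y, hp.fundamentalGroupToMulOpposite e α = MulOpposite.op (μ.map α) :=
    fun α => hp.fundamentalGroupToMulOpposite_apply_eq_Iff.2 ((hp.isMonodromy_iff hlam).1 hμ y y α)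
  constructor
  · intro α β hαβ
    refine hp.fundamentalGroupToMulOpposite_injective e ?_
    rw [h, h]
    exact congrArg _ hαβ
  · intro g
    obtain ⟨α, hα⟩ := hp.fundamentalGroupToMulOpposite_surjective e (MulOpposite.op g)
    exact ⟨α, MulOpposite.op_injective ((h α).symm.trans hα)⟩

end IsQuotientCoveringMap

/-! ### Transition homomorphisms -/

namespace GammaChart

variable {Γ E X : Type*} [Group Γ] [TopologicalSpace Γ] [TopologicalSpace E]
  [TopologicalSpace X] [MulAction Γ E] {q : E → X} {S : Set X} (φ : GammaChart Γ q S)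

/-- The `Γ`-coordinate of a chart. -/
def coord {z : E} (hz : q z ∈ S) : Γ := (φ.toHomeomorph ⟨z, hz⟩).2

/-- The point of the total space with given base point and `Γ`-coordinate. -/
def point {x : X} (hx : x ∈ S) (g : Γ) : E := (φ.toHomeomorph.symm (⟨x, hx⟩, g)).1

theorem proj_point_mem {x : X} (hx : x ∈ S) (g : Γ) : q (φ.point hx g) ∈ S :=
  (φ.toHomeomorph.symm (⟨x, hx⟩, g)).2

theorem proj_point {x : X} (hx : x ∈ S) (g : Γ) : q (φ.point hx g) = x := by
  have := φ.fst_apply (φ.toHomeomorph.symm (⟨x, hx⟩, g))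
  rw [Homeomorph.apply_symm_apply] at this
  exact this.symm

theorem coord_point {x : X} (hx : x ∈ S) (g : Γ) : φ.coord (φ.proj_point_mem hx g) = g :=
  congrArg Prod.snd (φ.toHomeomorph.apply_symm_apply (⟨x, hx⟩, g))

theorem point_coord {z : E} (hz : q z ∈ S) : φ.point hz (φ.coord hz) = z := by
  have h : φ.toHomeomorph ⟨z, hz⟩ = (⟨q z, hz⟩, φ.coord hz) :=
    Prod.ext (Subtype.ext (φ.fst_apply ⟨z, hz⟩)) rfl
  have := φ.toHomeomorph.symm_apply_apply ⟨z, hz⟩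
  rw [h] at this
  exact congrArg Subtype.val this

theorem coord_congr {z z' : E} (h : z = z') (hz : q z ∈ S) (hz' : q z' ∈ S) :
    φ.coord hz = φ.coord hz' := by
  subst h; rfl

theorem smul_point (hq : ∀ (g : Γ) (z : E), q (g • z) = q z) {x : X} (hx : x ∈ S) (g h : Γ) :
    g • φ.point hx h = φ.point hx (g * h) := by
  have hz : q (g • φ.point hx h) = x := (hq _ _).trans (φ.proj_point hx h)
  have hz' : q (g • φ.point hx h) ∈ S := Set.mem_of_eq_of_mem hz hx
  have key : φ.coord hz' = g * h :=
    (φ.equivariant g _ (φ.proj_point_mem hx h) hz').trans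
      (congrArg _ (φ.coord_point hx h))
  have := φ.point_coord hz'
  rw [key] at this
  rw [← this]
  congr

theorem coord_smul {z : E} (g : Γ) (hz : q z ∈ S) (hz' : q (g • z) ∈ S) :
    φ.coord hz' = g * φ.coord hz :=
  φ.equivariant g z hz hz'

theorem coord_eq_of_path [DiscreteTopology Γ] {z z' : E} (δ : Path z z')
    (h : ∀ s, q (δ s) ∈ S) (hz : q z ∈ S) (hz' : q z' ∈ S) : φ.coord hz = φ.coord hz' := by
  have hc : Continuous fun s => φ.coord (h s) :=
    continuous_snd.comp (φ.toHomeomorph.continuous.comp (δ.continuous.subtype_mk h))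
  have := PreconnectedSpace.constant inferInstance hc (x := 0) (y := 1)
  exact (φ.coord_congr δ.source.symm _ _).trans (this.trans (φ.coord_congr δ.target _ _))

end GammaChart

section Atlas

open EdgeGroupoid

variable {Γ E X ι : Type*} [Group Γ] [TopologicalSpace Γ] [TopologicalSpace E]
  [TopologicalSpace X] [MulAction Γ E] {q : E → X} {U : ι → Set X} (φ : GammaAtlas Γ q U)

theorem isTransition_iff {t : GroupoidToGroup (EdgeGroupoid (nerveOf U)) Γ} :
    IsTransition φ t ↔ ∀ (i j : (nerveOf U).Vert) (e : i ⟶ j) (z : E) (hi : q z ∈ coverSet U i)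
      (hj : q z ∈ coverSet U j), (φ j).coord hj = (φ i).coord hi * t.map (edge e) := by
  constructor
  · intro h i j e z hi hj
    have hz := (φ i).point_coord hi
    have := h i j e (q z) hi hj ((φ i).coord hi)
      (Set.mem_of_eq_of_mem (congrArg q hz) hj)
    exact ((φ j).coord_congr hz.symm _ _).trans (congrArg Prod.snd this)
  · intro h i j e x hi hj g hq
    refine Prod.ext (Subtype.ext ?_) ?_
    · exact ((φ j).fst_apply _).trans ((φ i).proj_point hi g)
    · exact (h i j e _ ((φ i).proj_point_mem hi g) hq).trans
        (congrArg (· * _) ((φ i).coord_point hi g))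

/-- A map of `Γ` commuting with left multiplications is a right multiplication, so over each point
the transition is determined by its value at `1`. That value is continuous on a connected
intersection with values in a discrete group, hence constant; a point over a triple intersection
gives the cocycle rule. -/
theorem existsUnique_isTransition [DiscreteTopology Γ] (hU : IsGoodCover U)
    (hq : ∀ (g : Γ) (z : E), q (g • z) = q z) : ∃! t, IsTransition φ t := by
  let T : ∀ (i j : (nerveOf U).Vert) (x : X), x ∈ coverSet U i → x ∈ coverSet U j → Γ :=
    fun i j x hi hj => (φ j).coord (z := (φ i).point hi 1) 
      (Set.mem_of_eq_of_mem ((φ i).proj_point hi 1) hj)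
  have hT : ∀ (i j : (nerveOf U).Vert) (z : E) (hi : q z ∈ coverSet U i)
      (hj : q z ∈ coverSet U j), (φ j).coord hj = (φ i).coord hi * T i j (q z) hi hj := by
    intro i j z hi hj
    have h : (φ i).coord hi • (φ i).point hi 1 = z := by
      rw [(φ i).smul_point hq, mul_one, (φ i).point_coord]
    rw [← (φ j).coord_smul _ _ (h.symm ▸ hj)]
    exact (φ j).coord_congr h.symm _ _
  have hconst : ∀ (i j : (nerveOf U).Vert) (x y : X) (hi : x ∈ coverSet U i)
      (hj : x ∈ coverSet U j) (hi' : y ∈ coverSet U i) (hj' : y ∈ coverSet U j),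
      T i j x hi hj = T i j y hi' hj' := by
    intro i j x y hi hj hi' hj'
    have := isPathConnected_iff_pathConnectedSpace.1 (hU.isPathConnected_inter hi hj)
    have hc : Continuous fun w : (coverSet U i ∩ coverSet U j : Set X) => T i j w w.2.1 w.2.2 := by
      refine continuous_snd.comp ((φ j).toHomeomorph.continuous.comp
        (Continuous.subtype_mk (continuous_subtype_val.comp
          ((φ i).toHomeomorph.symm.continuous.comp (Continuous.prodMk ?_ continuous_const))) _))
      exact continuous_subtype_val.subtype_mk _
    exact PreconnectedSpace.constant inferInstance hc (x := ⟨x, hi, hj⟩) (y := ⟨y, hi', hj'⟩)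
  let w : ∀ {i j : (nerveOf U).Vert}, (i ⟶ j) → Γ := fun {i j} e =>
    T i j _ (exists_mem_of_edge e).choose_spec.1 (exists_mem_of_edge e).choose_spec.2
  have hw : ∀ {i j : (nerveOf U).Vert} (e : i ⟶ j) (z : E) (hi : q z ∈ coverSet U i)
      (hj : q z ∈ coverSet U j), (φ j).coord hj = (φ i).coord hi * w e :=
    fun e z hi hj => (hT _ _ z hi hj).trans (congrArg _ (hconst _ _ _ _ hi hj
      (exists_mem_of_edge e).choose_spec.1 (exists_mem_of_edge e).choose_spec.2))
  obtain ⟨t, ht⟩ := exists_groupoidToGroup (K := nerveOf U) w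
    (fun {i} e => by
      obtain ⟨x, hi, -⟩ := exists_mem_of_edge e
      have h := hw e ((φ i).point hi 1) ((φ i).proj_point_mem hi 1) ((φ i).proj_point_mem hi 1)
      rwa [left_eq_mul] at h)
    (by
      rintro i j k e₁ e₂ e₃ ⟨s, ⟨-, x, hx⟩, hi, hj, hk⟩
      have hi : x ∈ coverSet U i := Set.mem_iInter₂.1 hx _ hi
      have hj : x ∈ coverSet U j := Set.mem_iInter₂.1 hx _ hj
      have hk : x ∈ coverSet U k := Set.mem_iInter₂.1 hx _ hk
      let z := (φ i).point hi 1
      have hz : q z = x := (φ i).proj_point hi 1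
      have zi : q z ∈ coverSet U i := Set.mem_of_eq_of_mem hz hi
      have zj : q z ∈ coverSet U j := Set.mem_of_eq_of_mem hz hj
      have zk : q z ∈ coverSet U k := Set.mem_of_eq_of_mem hz hk
      have h := hw e₂ z zj zk
      rw [hw e₁ z zi zj, hw e₃ z zi zk, mul_assoc] at h
      exact (mul_left_cancel h).symm)
  refine ⟨t, (isTransition_iff φ).2 fun i j e z hi hj => ?_, fun t' ht' => ?_⟩
  · rw [ht, hw e z hi hj]
  · refine groupoidToGroup_ext fun {i j} e => ?_
    obtain ⟨x, hi, hj⟩ := exists_mem_of_edge e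
    have hz := (φ i).proj_point hi 1
    have zi := Set.mem_of_eq_of_mem hz hi
    have zj := Set.mem_of_eq_of_mem hz hj
    have h := (isTransition_iff φ).1 ht' i j e ((φ i).point hi 1) zi zj
    rw [hw e _ zi zj] at h
    rw [ht, ← mul_left_cancel h]

end Atlas

/-! ### Transition homomorphisms and monodromy -/

namespace InducedCovering

open EdgeGroupoid

variable {X Y E Γ ι : Type*} [TopologicalSpace X] [TopologicalSpace Y] [TopologicalSpace E]
  [Group Γ] [MulAction Γ E] {f : C(X, Y)} {p : E → Y} (hp : IsQuotientCoveringMap p Γ)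
  {lam : Y → E} (hlam : ∀ y, p (lam y) = y)

/-- The pseudo-section of the pullback induced by a pseudo-section of `p`. -/
def pseudoSection (f : C(X, Y)) (x : X) : InducedCovering f hp :=
  ⟨(x, lam (f x)), (hlam (f x)).symm⟩

variable [TopologicalSpace Γ] [DiscreteTopology Γ] {U : ι → Set X} (hU : IsGoodCover U)
  {μ : GroupoidToGroup (FundamentalGroupoid Y) Γ} (hμ : IsMonodromy p lam μ)

include hμ

theorem coord_pseudoSection (i : (nerveOf U).Vert) (φ : GammaChart Γ (proj f hp) (coverSet U i))
    {x y : X} (hx : x ∈ coverSet U i) (hy : y ∈ coverSet U i) :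
    φ.coord (z := pseudoSection hp hlam f x) hx =
      μ.map ((FundamentalGroupoid.map f).map (hU.seg i hx hy)) *
        φ.coord (z := pseudoSection hp hlam f y) hy := by
  obtain ⟨γ, hγ⟩ := hU.exists_path i hx hy
  rw [hU.seg_eq i hx hy γ hγ]
  obtain ⟨δ, hδ⟩ := hμ ⟨f x⟩ ⟨f y⟩ (γ.map f.continuous)
  let g : Γ := μ.map ((FundamentalGroupoid.map f).map
    (FundamentalGroupoid.fromPath (Path.Homotopic.Quotient.mk γ)))
  -- Pairing `γ` with the lift of `f ∘ γ` gives a path in the pullback over `U i`, along which the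
  -- chart coordinate is constant.
  let δ' : Path (pseudoSection hp hlam f x) (g • pseudoSection hp hlam f y) :=
    { toFun := fun s => ⟨(γ s, δ s), (hδ s).symm⟩
      continuous_toFun := (γ.continuous.prodMk δ.continuous).subtype_mk _
      source' := Subtype.ext (Prod.ext γ.source δ.source)
      target' := Subtype.ext (Prod.ext γ.target δ.target) }
  rw [φ.coord_eq_of_path δ' hγ hx hy]
  exact φ.coord_smul g (z := pseudoSection hp hlam f y) hy hy

variable {r : (nerveOf U).Vert → X} (hr : ∀ i, r i ∈ coverSet U i)

/-- Compare the coordinates of the pseudo-section in both charts at a crossing point, then transport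
them to `r i` and `r j` by `coord_pseudoSection`. -/
theorem transition_eq (φ : GammaAtlas Γ (proj f hp) U)
    {t : GroupoidToGroup (EdgeGroupoid (nerveOf U)) Γ} (ht : IsTransition φ t) :
    t = μ.compConj (hU.realisation hr ⋙ FundamentalGroupoid.map f) fun v =>
      (φ v.as).coord (z := pseudoSection hp hlam f (r v.as)) (hr v.as) := by
  refine groupoidToGroup_ext fun {i j} e => ?_
  obtain ⟨x, hi, hj⟩ := exists_mem_of_edge e
  change t.map (edge e) = ((φ i).coord (z := pseudoSection hp hlam f (r i)) (hr i))⁻¹ *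
    μ.map ((FundamentalGroupoid.map f).map (hU.realise hr (edge e))) *
      (φ j).coord (z := pseudoSection hp hlam f (r j)) (hr j)
  have h := (isTransition_iff φ).1 ht i j e (pseudoSection hp hlam f x) hi hj
  rw [hU.realise_edge, hU.edgeClass_eq hr e hi hj, Functor.map_comp, μ.map_comp,
    coord_pseudoSection hp hlam hU hμ i (φ i) (hr i) hi]
  rw [coord_pseudoSection hp hlam hU hμ j (φ j) hj (hr j)] at h
  rw [mul_assoc, mul_assoc, h]
  group

end InducedCovering

/-! ### Charts over contractible sets -/

namespace IsQuotientCoveringMap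

variable {E Y Γ : Type*} [TopologicalSpace E] [TopologicalSpace Y] [Group Γ] [MulAction Γ E]
  {p : E → Y}

/-- A contractible space need not be locally path connected, so instead of the lifting criterion one
lifts a contraction run backwards, from a constant map to `h`. A deck transformation then moves the
lift through `e₀`. -/
theorem exists_lift_of_contractibleSpace (hp : IsQuotientCoveringMap p Γ) {A : Type*}
    [TopologicalSpace A] [ContractibleSpace A] (h : C(A, Y)) (a₀ : A) (e₀ : E)
    (he : p e₀ = h a₀) : ∃ s : C(A, E), (∀ a, p (s a) = h a) ∧ s a₀ = e₀ := by
  have := hp.toContinuousConstSMul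
  obtain ⟨c, ⟨H⟩⟩ := id_nullhomotopic A
  obtain ⟨e₁, he₁⟩ := hp.surjective (h c)
  let H' : C(unitInterval × A, Y) := h.comp H.symm.toContinuousMap
  have h0 : ∀ a, H' (0, a) = p (ContinuousMap.const A e₁ a) := fun a =>
    (congrArg h (H.symm.apply_zero a)).trans he₁.symm
  let L := hp.isCoveringMap.liftHomotopy H' (ContinuousMap.const A e₁) h0
  have hL : ∀ a, p (L (1, a)) = h a := fun a =>
    (congrFun (hp.isCoveringMap.liftHomotopy_lifts H' _ h0) (1, a)).trans
      (congrArg h (H.symm.apply_one a))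
  obtain ⟨g, hg⟩ := hp.apply_eq_iff_mem_orbit.1 (he.trans (hL a₀).symm)
  exact ⟨⟨fun a => g • L (1, a), by fun_prop⟩, fun a => (hp.map_smul g).trans (hL a), hg⟩

/-- Near `a` both `s b` and `(g a)⁻¹ • s' b` lie in a set `V` disjoint from its nontrivial
translates, and they differ by `(g a)⁻¹ * g b`. -/
theorem isLocallyConstant_of_smul_eq (hp : IsQuotientCoveringMap p Γ) {A : Type*}
    [TopologicalSpace A] {s s' : A → E} (hs : Continuous s) (hs' : Continuous s') {g : A → Γ}
    (h : ∀ a, g a • s a = s' a) : IsLocallyConstant g := by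
  have := hp.toContinuousConstSMul
  rw [IsLocallyConstant.iff_eventually_eq]
  intro a
  obtain ⟨V, hV, hdisj⟩ := hp.disjoint (s a)
  have hc : Continuous fun b => (g a)⁻¹ • s' b := hs'.const_smul _
  have ha : (g a)⁻¹ • s' a = s a := by rw [← h, inv_smul_smul]
  filter_upwards [hs.continuousAt.preimage_mem_nhds hV,
    hc.continuousAt.preimage_mem_nhds (by rwa [ha])] with b hb hb'
  have : (g a)⁻¹ * g b = 1 := hdisj _ ⟨(g a)⁻¹ • s' b, ⟨s b, hb, by
    rw [← h]; exact mul_smul _ _ _⟩, hb'⟩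
  rw [inv_mul_eq_one] at this
  exact this.symm

end IsQuotientCoveringMap

namespace InducedCovering

variable {X Y E Γ : Type*} [TopologicalSpace X] [TopologicalSpace Y] [TopologicalSpace E]
  [Group Γ] [MulAction Γ E] {f : C(X, Y)} {p : E → Y} (hp : IsQuotientCoveringMap p Γ)

theorem continuous_proj : Continuous (proj f hp) :=
  continuous_fst.comp continuous_subtype_val

theorem continuous_point : Continuous fun z : InducedCovering f hp => z.1.2 :=
  continuous_snd.comp continuous_subtype_val

variable [TopologicalSpace Γ] [DiscreteTopology Γ]

/-- A lift `s` of `f` over `S` trivialises the pullback by `(x, g) ↦ g • s x`. Letting `s` pass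
through the point of `z₀` normalises the coordinate there. -/
theorem exists_chart {S : Set X} [ContractibleSpace S] (z₀ : InducedCovering f hp)
    (hz₀ : proj f hp z₀ ∈ S) : ∃ φ : GammaChart Γ (proj f hp) S, φ.coord hz₀ = 1 := by
  have := hp.toContinuousConstSMul
  obtain ⟨s, hs, hs₀⟩ := hp.exists_lift_of_contractibleSpace
    (f.comp ⟨Subtype.val, continuous_subtype_val⟩ : C(S, Y)) ⟨proj f hp z₀, hz₀⟩ z₀.1.2 z₀.2.symm
  have hex : ∀ z : (proj f hp ⁻¹' S : Set _), ∃ g : Γ,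
      g • s ⟨proj f hp z, z.2⟩ = z.1.1.2 :=
    fun z => hp.apply_eq_iff_mem_orbit.1 (z.1.2.symm.trans (hs ⟨proj f hp z, z.2⟩).symm)
  choose c hc using hex
  have hfst : Continuous fun z : (proj f hp ⁻¹' S : Set _) => (⟨proj f hp z, z.2⟩ : S) :=
    ((continuous_proj hp).comp continuous_subtype_val).subtype_mk _
  have hsnd : Continuous fun z : (proj f hp ⁻¹' S : Set _) => z.1.1.2 :=
    (continuous_point hp).comp continuous_subtype_val
  have hcc : Continuous c :=
    (hp.isLocallyConstant_of_smul_eq (s.continuous.comp hfst) hsnd hc).continuous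
  have hinv : Continuous fun w : S × Γ => w.2 • s w.1 :=
    continuous_prod_of_discrete_right.2 fun g => s.continuous.const_smul g
  have hcu : ∀ (z : (proj f hp ⁻¹' S : Set _)) (g : Γ),
      g • s ⟨proj f hp z, z.2⟩ = z.1.1.2 → c z = g :=
    fun z g h => hp.smul_left_injective ((hc z).trans h.symm)
  refine ⟨
    { toHomeomorph :=
        { toFun := fun z => (⟨proj f hp z, z.2⟩, c z)
          invFun := fun w => ⟨⟨(w.1.1, w.2 • s w.1), ((hp.map_smul _).trans (hs w.1)).symm⟩, w.1.2⟩
          left_inv := fun z => Subtype.ext (Subtype.ext (Prod.ext rfl (hc z)))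
          right_inv := fun w => Prod.ext rfl (hcu _ _ rfl)
          continuous_toFun := hfst.prodMk hcc
          continuous_invFun := (((continuous_subtype_val.comp continuous_fst).prodMk
            hinv).subtype_mk _).subtype_mk _ }
      fst_apply := fun _ => rfl
      equivariant := fun g z hz hgz => hcu _ _ ?_ }, hcu _ _ ?_⟩
  · rw [mul_smul]
    exact congrArg (g • ·) (hc ⟨z, hz⟩)
  · rw [one_smul]
    exact hs₀

end InducedCovering

/-! ### The theorem, assembled -/

theorem mainTheorem2 {X Y E ι Γ : Type*} [TopologicalSpace X] [TopologicalSpace Y]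
    [TopologicalSpace E] [Group Γ] [TopologicalSpace Γ] [DiscreteTopology Γ] [MulAction Γ E]
    -- the universal covering `p : E → Y`, the quotient by a covering space action of `Γ`
    (p : E → Y) (hp : IsQuotientCoveringMap p Γ) [SimplyConnectedSpace E]
    (f : C(X, Y)) (U : ι → Set X) (hU : IsGoodCover U)
    (r : (nerveOf U).Vert → X) (hr : ∀ i, r i ∈ coverSet U i) :
    -- the homomorphisms `R`, `μ_lam` and `t` are well defined
    (∃! R, IsRealisation U r R) ∧
    (∀ lam : Y → E, (∀ y, p (lam y) = y) →
      ∃! μ : GroupoidToGroup (FundamentalGroupoid Y) Γ, IsMonodromy p lam μ) ∧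
    (∀ φ : GammaAtlas Γ (InducedCovering.proj f hp) U, ∃! t, IsTransition φ t) ∧
    ∀ R, IsRealisation U r R →
      -- `R` is an isomorphism from the edge group at `i` to `π₁(X, R(i))`
      (∀ i, Function.Bijective (R.mapVertexGroup (EdgeGroupoid.vertex i))) ∧
      -- the monodromy is an isomorphism from `π₁(Y, y)` to `Γ`
      (∀ (lam : Y → E) (μ : GroupoidToGroup (FundamentalGroupoid Y) Γ),
        (∀ y, p (lam y) = y) → IsMonodromy p lam μ →
        ∀ y : FundamentalGroupoid Y, Function.Bijective (μ.onVertexGroup y)) ∧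
      -- for every atlas and every vertex, the square commutes for a suitable pseudo-section,
      -- and for every pseudo-section up to an inner automorphism of `Γ`
      (∀ (φ : GammaAtlas Γ (InducedCovering.proj f hp) U)
          (t : GroupoidToGroup (EdgeGroupoid (nerveOf U)) Γ), IsTransition φ t →
        ∀ i : (nerveOf U).Vert,
          (∃ (lam : Y → E) (μ : GroupoidToGroup (FundamentalGroupoid Y) Γ),
            (∀ y, p (lam y) = y) ∧ IsMonodromy p lam μ ∧ SquareCommutes f R μ t i) ∧
          (∀ (lam : Y → E) (μ : GroupoidToGroup (FundamentalGroupoid Y) Γ),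
            (∀ y, p (lam y) = y) → IsMonodromy p lam μ →
            ∃ θ : Γ, ∀ α : EdgeGroupoid.vertex i ⟶ EdgeGroupoid.vertex i,
              t.map α = θ⁻¹ * μ.map ((FundamentalGroupoid.map f).map (R.map α)) * θ)) ∧
      -- for every pseudo-section there is an atlas for which all the squares commute
      (∀ (lam : Y → E) (μ : GroupoidToGroup (FundamentalGroupoid Y) Γ),
        (∀ y, p (lam y) = y) → IsMonodromy p lam μ →
        ∃ (φ : GammaAtlas Γ (InducedCovering.proj f hp) U)
          (t : GroupoidToGroup (EdgeGroupoid (nerveOf U)) Γ),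
          IsTransition φ t ∧ ∀ i, SquareCommutes f R μ t i) := by
  have hfree : ∀ {φ : GammaAtlas Γ (InducedCovering.proj f hp) U}
      {t : GroupoidToGroup (EdgeGroupoid (nerveOf U)) Γ}, IsTransition φ t →
      ∀ {lam : Y → E} {μ : GroupoidToGroup (FundamentalGroupoid Y) Γ}
        (hlam : ∀ y, p (lam y) = y), IsMonodromy p lam μ →
      ∀ {i : (nerveOf U).Vert},
        (φ i).coord (z := InducedCovering.pseudoSection hp hlam f (r i)) (hr i) = 1 →
        SquareCommutes f (hU.realisation hr) μ t i := by
    intro φ t ht lam μ hlam hμ i h1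
    refine MonoidHom.ext fun α => ?_
    have := InducedCovering.transition_eq hp hlam hU hμ hr φ ht
    rw [this]
    change ((φ i).coord (z := InducedCovering.pseudoSection hp hlam f (r i)) (hr i))⁻¹ * _ *
      (φ i).coord (z := InducedCovering.pseudoSection hp hlam f (r i)) (hr i) = _
    rw [h1, inv_one, one_mul, mul_one]
    rfl
  refine ⟨⟨hU.realisation hr, hU.isRealisation_realisation hr, fun R hR => hU.eq_realisation hr hR⟩,
    fun lam hlam => hp.existsUnique_isMonodromy hlam,
    fun φ => existsUnique_isTransition φ hU fun _ _ => rfl, fun R hR => ?_⟩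
  obtain rfl := hU.eq_realisation hr hR
  refine ⟨fun i => ⟨hU.realisation_injective hr i, hU.realisation_surjective hr i⟩,
    fun lam μ hlam hμ y => hp.bijective_onVertexGroup hlam hμ y, fun φ t ht i => ⟨?_, ?_⟩,
    fun lam μ hlam hμ => ?_⟩
  · classical
    let z : InducedCovering f hp := (φ i).point (hr i) 1
    have hz : z.1.1 = r i := (φ i).proj_point (hr i) 1
    -- Any set-theoretic section is changed at `f (r i)` to pass through the point over `r i` with
    -- coordinate `1`. Other vertices may have the same image under `f ∘ r`, so this treats one
    -- vertex at a time.
    let lam : Y → E := Function.update (Function.surjInv hp.surjective) (f (r i)) z.1.2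
    have hself : lam (f (r i)) = z.1.2 := Function.update_self _ _ _
    have hlam : ∀ y, p (lam y) = y := by
      intro y
      by_cases h : y = f (r i)
      · rw [h, hself, ← z.2, hz]
      · exact (congrArg p (Function.update_of_ne h _ _)).trans
          (Function.surjInv_eq hp.surjective y)
    obtain ⟨μ, hμ, -⟩ := hp.existsUnique_isMonodromy hlam
    refine ⟨lam, μ, hlam, hμ, hfree ht hlam hμ ?_⟩
    have h : InducedCovering.pseudoSection hp hlam f (r i) = z :=
      Subtype.ext (Prod.ext hz.symm hself)
    exact ((φ i).coord_congr h _ _).trans ((φ i).coord_point (hr i) 1)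
  · intro lam μ hlam hμ
    refine ⟨(φ i).coord (z := InducedCovering.pseudoSection hp hlam f (r i)) (hr i), fun α => ?_⟩
    rw [InducedCovering.transition_eq hp hlam hU hμ hr φ ht]
    rfl
  · have hex : ∀ i : (nerveOf U).Vert,
        ∃ φ : GammaChart Γ (InducedCovering.proj f hp) (coverSet U i),
          φ.coord (z := InducedCovering.pseudoSection hp hlam f (r i)) (hr i) = 1 := fun i =>
      have := hU.contractibleSpace_coverSet i
      InducedCovering.exists_chart hp _ _
    choose φ hφ using hex
    obtain ⟨t, ht, -⟩ := existsUnique_isTransition (q := InducedCovering.proj f hp) φ hU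
      fun _ _ => rfl
    exact ⟨φ, t, ht, fun i => hfree ht hlam hμ (hφ i)⟩
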